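/- Let $q=e^{-2i\pi\tau}$ be a complex number with $|q|>1$, and put $q_l=e^{-2i\pi\tau/l}$ for $l\ge 1$. Let $K$ be one of the fields $\mathcal M(\mathbf C)$ (meromorphic functions on $\mathbf C$), $\mathbf C(\{z\})$ (convergent Laurent series) or $\mathbf C((z))$, with the $z$-adic valuation $v_0$ and the automorphism $\sigma_q:f(z)\mapsto f(qz)$. For $l\ge 1$ let $K_l\supset K$ be the field of the same kind in a variable $z_l$ with $z_l^l=z$, with its $z_l$-adic valuation and the automorphism $\sigma_{q_l}:f(z_l)\mapsto f(q_lz_l)$, which extends $\sigma_q$. A $q$-difference module over $K$ is a pair $(M,\Phi)$ with $M$ a finite-dimensional $K$-vector space and $\Phi$ a $\sigma_q$-linear automorphism of $M$; morphisms are the $K$-linear maps commuting with the automorphisms. The tensor product $M_1\otimes M_2$ carries $\Phi_1\otimes\Phi_2$, and the dual $M^\vee=\mathrm{Hom}_K(M,K)$ carries $u\mapsto\sigma_q\circ u\circ\Phi^{-1}$. The same definitions apply over $(K_l,\sigma_{q_l})$. Newton function. For every $q$-difference module $M$ there are $l\ge 1$ and a filtration $0=F_0\subset F_1\subset\dots\subset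 F_n=K_l\otimes_KM$ by difference submodules over $(K_l,\sigma_{q_l})$ whose quotients $F_i/F_{i-1}$ are of rank one, spanned by a vector $e$ with $\Phi e=a_ie$, $a_i\in K_l^*$. The function $r_M:\mathbf Q\to\mathbf N$ of finite support given by $r_M(\mu)=\#\{i : v_0(a_i)/l=\mu\}$ (with $v_0$ the $z_l$-adic valuation) depends only on $M$; it is called the Newton function of $M$. Newton polygon. $N(M)\subset\mathbf R^2$ is the convex region above the polygonal line which starts at $(0,0)$ and consists of the vectors $(r_M(\mu),r_M(\mu)\mu)$ in increasing order of the slopes $\mu$; that is, the convex hull of the vertical half-lines going up from the vertices of this line. Then: (i) For every exact sequence $0\to M'\to M\to M''\to 0$ of $q$-difference modules, $r_M=r_{M'}+r_{M''}$ and $N(M)=N(M')+N(M'')$ (Minkowski sum). (ii) For all $q$-difference modules $M_1,M_2$ and all $\mu\in\mathbf Q$, $$r_{M_1\otimes M_2}(\mu)=\sum_{\mu_1+\mu_2=\mu}r_{M_1}(\mu_1)\,r_{M_2}(\mu_2).$$ (iii) For every $q$-difference module $M$ and all $\mu\in\mathbf Q$, $r_{M^\vee}(\mu)=r_M(-\mu)$.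 -/

import Mathlib

open scoped TensorProduct Pointwise Topology

attribute [local instance] RingHomInvPair.of_ringEquiv RingHomInvPair.of_ringEquiv_symm

noncomputable section

namespace QDiff

/-! ### Laurent expansions and the base fields -/

/-- `f` is the Laurent expansion at `0` of the function `F`: the series converges to `F`
on a punctured neighbourhood of `0`. -/
def IsLaurentExpansion (f : LaurentSeries ℂ) (F : ℂ → ℂ) : Prop :=
  ∀ᶠ z in 𝓝[≠] (0 : ℂ), HasSum (fun n : ℤ => f.coeff n * z ^ n) (F z)

namespace IsLaurentExpansion

lemma congr {f : LaurentSeries ℂ} {F G : ℂ → ℂ} (h : IsLaurentExpansion f F)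
    (hFG : ∀ᶠ z in 𝓝[≠] (0 : ℂ), F z = G z) : IsLaurentExpansion f G := by
  filter_upwards [h, hFG] with z h1 h2
  rwa [← h2]

lemma single (n : ℤ) (c : ℂ) :
    IsLaurentExpansion (HahnSeries.single n c) (fun z => c * z ^ n) := by
  refine Filter.Eventually.of_forall fun z => ?_
  have := hasSum_single (f := fun m : ℤ => (HahnSeries.single n c).coeff m * z ^ m) n
    (fun m hm => by simp [HahnSeries.coeff_single_of_ne hm])
  simpa using this

lemma one : IsLaurentExpansion 1 (fun _ => 1) := by
  simpa using single 0 1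

lemma zero : IsLaurentExpansion 0 (fun _ => 0) := by
  refine Filter.Eventually.of_forall fun z => ?_
  simp

lemma add {f g : LaurentSeries ℂ} {F G : ℂ → ℂ} (hf : IsLaurentExpansion f F)
    (hg : IsLaurentExpansion g G) : IsLaurentExpansion (f + g) (F + G) := by
  filter_upwards [hf, hg] with z h1 h2
  simpa [add_mul] using h1.add h2

lemma neg {f : LaurentSeries ℂ} {F : ℂ → ℂ} (hf : IsLaurentExpansion f F) :
    IsLaurentExpansion (-f) (-F) := by
  filter_upwards [hf] with z h1
  simpa using h1.neg

lemma mul {f g : LaurentSeries ℂ} {F G : ℂ → ℂ} (hf : IsLaurentExpansion f F)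
    (hg : IsLaurentExpansion g G) : IsLaurentExpansion (f * g) (F * G) := by
  filter_upwards [hf, hg, self_mem_nhdsWithin] with z h1 h2 hz
  have hz : z ≠ 0 := hz
  have hs := summable_mul_of_summable_norm h1.summable.norm h2.summable.norm
  have h3 := h1.mul h2 hs
  let e : ℤ × ℤ ≃ ℤ × ℤ :=
    { toFun := fun p => (p.2, p.1 - p.2)
      invFun := fun p => (p.1 + p.2, p.1)
      left_inv := fun p => by simp
      right_inv := fun p => by simp }
  have h4 := (e.hasSum_iff).mpr h3
  refine h4.prod_fiberwise fun k => ?_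
  have h5 : (f * g).coeff k * z ^ k =
      ∑ n ∈ (Finset.antidiagonal f.isPWO_support g.isPWO_support k).image Prod.fst,
        (f.coeff n * z ^ n) * (g.coeff (k - n) * z ^ (k - n)) := by
    rw [Finset.sum_image, HahnSeries.coeff_mul, Finset.sum_mul]
    · refine Finset.sum_congr rfl fun p hp => ?_
      have hp' : p.1 + p.2 = k := (Finset.mem_antidiagonal.mp hp).2.2
      have : k - p.1 = p.2 := by omega
      rw [this, ← hp', zpow_add₀ hz]
      ring
    · intro p hp p' hp' hpp
      have h1 : p.1 + p.2 = k := (Finset.mem_antidiagonal.mp hp).2.2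
      have h2 : p'.1 + p'.2 = k := (Finset.mem_antidiagonal.mp hp').2.2
      have hpp : p.1 = p'.1 := hpp
      exact Prod.ext hpp (by omega)
  rw [h5]
  refine hasSum_sum_of_ne_finset_zero fun n hn => ?_
  by_contra hne
  apply hn
  rw [Finset.mem_image]
  have ha : f.coeff n ≠ 0 := fun h => hne (by simp [e, h])
  have hb : g.coeff (k - n) ≠ 0 := fun h => hne (by simp [e, h])
  exact ⟨(n, k - n), Finset.mem_antidiagonal.mpr ⟨ha, hb, by simp⟩, rfl⟩

lemma ofPowerSeries {P : PowerSeries ℂ} {F : ℂ → ℂ} :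
    IsLaurentExpansion (HahnSeries.ofPowerSeries ℤ ℂ P) F ↔
      ∀ᶠ z in 𝓝[≠] (0 : ℂ), HasSum (fun n : ℕ => PowerSeries.coeff n P * z ^ n) (F z) := by
  have key : ∀ z : ℂ, (HasSum (fun n : ℕ => PowerSeries.coeff n P * z ^ n) (F z) ↔
      HasSum (fun n : ℤ => (HahnSeries.ofPowerSeries ℤ ℂ P).coeff n * z ^ n) (F z)) := by
    intro z
    rw [← (Nat.cast_injective (R := ℤ)).hasSum_iff]
    · simp only [Function.comp_def, zpow_natCast]
      simp only [LaurentSeries.coeff_coe_powerSeries]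
    · intro n hn
      have hneg : n < 0 := by
        by_contra h
        exact hn ⟨n.toNat, by simp; omega⟩
      rw [PowerSeries.coeff_coe]
      simp [hneg]
  unfold IsLaurentExpansion
  simp only [key]

/-- A function meromorphic at `0` has a Laurent expansion. -/
lemma exists_of_meromorphicAt {F : ℂ → ℂ} (hF : MeromorphicAt F 0) :
    ∃ f, IsLaurentExpansion f F := by
  obtain ⟨N, p, hp⟩ := hF
  rw [hasFPowerSeriesAt_iff] at hp
  refine ⟨HahnSeries.single (-(N : ℤ)) 1 *
    HahnSeries.ofPowerSeries ℤ ℂ (PowerSeries.mk p.coeff), ?_⟩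
  have h1 : IsLaurentExpansion (HahnSeries.ofPowerSeries ℤ ℂ (PowerSeries.mk p.coeff))
      (fun z => z ^ N * F z) := by
    rw [ofPowerSeries]
    filter_upwards [hp.filter_mono nhdsWithin_le_nhds] with z hz
    simpa [mul_comm] using hz
  refine ((single (-(N : ℤ)) 1).mul h1).congr ?_
  filter_upwards [self_mem_nhdsWithin] with z hz
  have hz : z ≠ 0 := hz
  simp [hz]

/-- The Laurent expansion of the zero function is zero. -/
lemma eq_zero {f : LaurentSeries ℂ} (hf : IsLaurentExpansion f 0) : f = 0 := by
  by_contra hne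
  set P := f.powerSeriesPart with hP
  have h1 : IsLaurentExpansion (HahnSeries.ofPowerSeries ℤ ℂ P) 0 := by
    have h2 := (single (-f.order) 1).mul hf
    rw [mul_zero] at h2
    have h3 : HahnSeries.single (-f.order) (1 : ℂ) * f = HahnSeries.ofPowerSeries ℤ ℂ P := by
      conv_lhs => rw [← LaurentSeries.single_order_mul_powerSeriesPart f]
      rw [← mul_assoc, HahnSeries.single_mul_single]
      simp [hP]
    rwa [h3] at h2
  rw [ofPowerSeries] at h1
  let p : FormalMultilinearSeries ℂ ℂ ℂ := FormalMultilinearSeries.ofScalars ℂ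
    (fun n => PowerSeries.coeff n P)
  have hpc : ∀ n, p.coeff n = PowerSeries.coeff n P := fun n => by
    simp [p, FormalMultilinearSeries.coeff_ofScalars]
  let G : ℂ → ℂ := fun z => if z = 0 then PowerSeries.coeff 0 P else 0
  have hG : HasFPowerSeriesAt G p 0 := by
    rw [hasFPowerSeriesAt_iff]
    rw [eventually_nhdsWithin_iff] at h1
    filter_upwards [h1] with z hz
    by_cases h : z = 0
    · subst h
      have := hasSum_single (f := fun n : ℕ => (0 : ℂ) ^ n • p.coeff n) 0
        (fun m hm => by simp [hm])
      simpa [G, hpc] using this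
    · simpa [G, h, hpc, mul_comm] using hz h
  have hc : Filter.Tendsto G (𝓝[≠] 0) (𝓝 (G 0)) :=
    hG.continuousAt.tendsto.mono_left nhdsWithin_le_nhds
  have hc0 : Filter.Tendsto G (𝓝[≠] 0) (𝓝 0) := by
    refine tendsto_const_nhds.congr' ?_
    filter_upwards [self_mem_nhdsWithin] with z hz
    have hz : z ≠ 0 := hz
    simp [G, hz]
  have h0 : PowerSeries.coeff 0 P = 0 := by
    simpa [G] using tendsto_nhds_unique hc hc0
  have : PowerSeries.coeff 0 P = f.coeff f.order := by
    rw [hP, LaurentSeries.powerSeriesPart_coeff]; simp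
  exact HahnSeries.coeff_order_eq_zero.not.mpr hne (this ▸ h0)

lemma unique {f g : LaurentSeries ℂ} {F G : ℂ → ℂ} (hf : IsLaurentExpansion f F)
    (hg : IsLaurentExpansion g G) (h : ∀ᶠ z in 𝓝[≠] (0 : ℂ), F z = G z) : f = g := by
  have := hf.add hg.neg
  have h0 : IsLaurentExpansion (f + -g) 0 := this.congr (by
    filter_upwards [h] with z hz
    simp [hz])
  have := h0.eq_zero
  rwa [← sub_eq_add_neg, sub_eq_zero] at this

lemma inv {f : LaurentSeries ℂ} {F : ℂ → ℂ} (hF : MeromorphicAt F 0)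
    (hf : IsLaurentExpansion f F) : IsLaurentExpansion f⁻¹ F⁻¹ := by
  rcases hF.eventually_eq_zero_or_eventually_ne_zero with h | h
  · have : f = 0 := hf.unique zero h
    subst this
    rw [inv_zero]
    refine zero.congr ?_
    filter_upwards [h] with z hz
    simp [hz]
  · obtain ⟨g, hg⟩ := exists_of_meromorphicAt hF.inv
    have h1 : f * g = 1 := (hf.mul hg).unique one (by
      filter_upwards [h] with z hz
      simp [hz])
    rwa [← eq_inv_of_mul_eq_one_right h1]

end IsLaurentExpansion

/-- The field of Laurent expansions at `0 ∈ U` of the functions that are meromorphic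
on (a neighbourhood of) `U`. -/
def laurentSubfield (U : Set ℂ) (hU : (0 : ℂ) ∈ U) : Subfield (LaurentSeries ℂ) where
  carrier := {f | ∃ F : ℂ → ℂ, MeromorphicOn F U ∧ IsLaurentExpansion f F}
  zero_mem' := ⟨_, MeromorphicOn.const 0, IsLaurentExpansion.zero⟩
  one_mem' := ⟨_, MeromorphicOn.const 1, IsLaurentExpansion.one⟩
  add_mem' := by
    rintro f g ⟨F, hF, hf⟩ ⟨G, hG, hg⟩
    exact ⟨_, hF.add hG, hf.add hg⟩
  neg_mem' := by
    rintro f ⟨F, hF, hf⟩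
    exact ⟨_, hF.neg, hf.neg⟩
  mul_mem' := by
    rintro f g ⟨F, hF, hf⟩ ⟨G, hG, hg⟩
    exact ⟨_, hF.mul hG, hf.mul hg⟩
  inv_mem' := by
    rintro f ⟨F, hF, hf⟩
    exact ⟨_, hF.inv, hf.inv (hF 0 hU)⟩

/-- The three kinds of base field. -/
inductive BaseField : Type
  | meromorphic
  | convergent
  | formal

/-- The base field `K`, as a field of Laurent series: `ℳ(ℂ)` (functions meromorphic on `ℂ`,
identified with their Laurent expansions at `0`), `ℂ({z})` (germs at `0` of meromorphic functions,
that is, convergent Laurent series) or `ℂ((z))`. -/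
def BaseField.toSubfield : BaseField → Subfield (LaurentSeries ℂ)
  | .meromorphic => laurentSubfield Set.univ (Set.mem_univ _)
  | .convergent => laurentSubfield {0} (Set.mem_singleton _)
  | .formal => ⊤

/-- The field `K`. -/
abbrev BaseField.K (k : BaseField) : Type := k.toSubfield

/-- The `z`-adic valuation `v₀(a)` of an element `a ≠ 0` of `K`. -/
def BaseField.v₀ {k : BaseField} (a : k.K) : ℤ := (a : LaurentSeries ℂ).order

/-! ### The automorphism `f(z) ↦ f(cz)` -/

/-- `f(z) ↦ f(cz)` on Laurent series. -/
def dilate (c : ℂˣ) : LaurentSeries ℂ →+* LaurentSeries ℂ where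
  toFun f :=
    { coeff := fun n => ((c ^ n : ℂˣ) : ℂ) * f.coeff n
      isPWO_support' := f.isPWO_support.mono (fun n hn h => hn (by simp [h])) }
  map_one' := by
    ext n
    by_cases h : n = 0
    · subst h; simp
    · simp [HahnSeries.coeff_one, h]
  map_zero' := by ext n; simp
  map_add' f g := by ext n; simp [mul_add]
  map_mul' f g := by
    ext k
    simp only [HahnSeries.coeff_mul, Finset.mul_sum]
    have hne : ∀ n : ℤ, (c : ℂ) ^ n ≠ 0 := fun n => zpow_ne_zero n c.ne_zero
    refine Finset.sum_congr ?_ ?_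
    · ext p
      simp [Finset.mem_antidiagonal, hne]
    · intro p hp
      have hp' : p.1 + p.2 = k := (Finset.mem_antidiagonal.mp hp).2.2
      rw [← hp', zpow_add]
      push_cast
      ring

@[simp] lemma dilate_coeff (c : ℂˣ) (f : LaurentSeries ℂ) (n : ℤ) :
    (dilate c f).coeff n = (c : ℂ) ^ n * f.coeff n := by
  change ((c ^ n : ℂˣ) : ℂ) * f.coeff n = _
  simp

lemma IsLaurentExpansion.dilate {f : LaurentSeries ℂ} {F : ℂ → ℂ}
    (hf : IsLaurentExpansion f F) (c : ℂˣ) :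
    IsLaurentExpansion (dilate c f) (fun z => F (c * z)) := by
  have ht : Filter.Tendsto (fun z : ℂ => (c : ℂ) * z) (𝓝[≠] 0) (𝓝[≠] 0) := by
    refine tendsto_nhdsWithin_of_tendsto_nhds_of_eventually_within _ ?_ ?_
    · have : Filter.Tendsto (fun z : ℂ => (c : ℂ) * z) (𝓝 0) (𝓝 (c * 0)) :=
        (continuous_const.mul continuous_id).tendsto _
      rw [mul_zero] at this
      exact this.mono_left nhdsWithin_le_nhds
    · filter_upwards [self_mem_nhdsWithin] with z hz
      exact mul_ne_zero c.ne_zero hz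
  filter_upwards [ht.eventually hf] with z hz
  refine hz.congr_fun ?_
  intro n
  simp [mul_zpow]
  ring

lemma dilate_mem (k : BaseField) (c : ℂˣ) {f : LaurentSeries ℂ} (hf : f ∈ k.toSubfield) :
    dilate c f ∈ k.toSubfield := by
  have hmero : ∀ (F : ℂ → ℂ) (z : ℂ), MeromorphicAt F (c * z) →
      MeromorphicAt (fun z => F (c * z)) z := fun F z h =>
    MeromorphicAt.comp_analyticAt (f := F) (g := fun z => (c : ℂ) * z) h (by fun_prop)
  cases k with
  | meromorphic =>
    obtain ⟨F, hF, hf⟩ := hf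
    exact ⟨_, fun z _ => hmero F z (hF _ (Set.mem_univ _)), hf.dilate c⟩
  | convergent =>
    obtain ⟨F, hF, hf⟩ := hf
    refine ⟨_, fun z hz => hmero F z (hF _ ?_), hf.dilate c⟩
    rw [Set.mem_singleton_iff] at hz ⊢
    rw [hz, mul_zero]
  | formal => trivial

/-- The automorphism `σ_c : f(z) ↦ f(cz)` of `K`. -/
def sigma (k : BaseField) (c : ℂˣ) : k.K ≃+* k.K where
  toFun f := ⟨dilate c f, dilate_mem k c f.2⟩
  invFun f := ⟨dilate c⁻¹ f, dilate_mem k c⁻¹ f.2⟩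
  left_inv f := by
    ext n
    have : (c : ℂ) ^ n ≠ 0 := zpow_ne_zero n c.ne_zero
    simp [this]
  right_inv f := by
    ext n
    have : (c : ℂ) ^ n ≠ 0 := zpow_ne_zero n c.ne_zero
    simp [this]
  map_mul' f g := by ext1; simp
  map_add' f g := by ext1; simp

/-! ### Ramification `z = z_l ^ l` -/

/-- `f(z) ↦ f(z ^ l)` on Laurent series. -/
def ramify (l : ℕ+) : LaurentSeries ℂ →+* LaurentSeries ℂ :=
  HahnSeries.embDomainRingHom (AddMonoidHom.mulLeft (l : ℤ))
    (fun a b h => by simpa using h)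
    (fun a b => by
      simp)

lemma ramify_coeff_mul (l : ℕ+) (f : LaurentSeries ℂ) (n : ℤ) :
    (ramify l f).coeff (l * n) = f.coeff n :=
  HahnSeries.embDomain_coeff (f := ⟨⟨AddMonoidHom.mulLeft (l : ℤ), _⟩, _⟩) (a := n)

lemma ramify_coeff_of_not_dvd (l : ℕ+) (f : LaurentSeries ℂ) (n : ℤ) (h : ¬ ((l : ℤ) ∣ n)) :
    (ramify l f).coeff n = 0 :=
  HahnSeries.embDomain_of_notMem_range (f := ⟨⟨AddMonoidHom.mulLeft (l : ℤ), _⟩, _⟩) (by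
    rintro ⟨m, hm⟩
    exact h ⟨m, hm.symm⟩)

lemma IsLaurentExpansion.ramify {f : LaurentSeries ℂ} {F : ℂ → ℂ}
    (hf : IsLaurentExpansion f F) (l : ℕ+) :
    IsLaurentExpansion (ramify l f) (fun z => F (z ^ (l : ℕ))) := by
  have ht : Filter.Tendsto (fun z : ℂ => z ^ (l : ℕ)) (𝓝[≠] 0) (𝓝[≠] 0) := by
    refine tendsto_nhdsWithin_of_tendsto_nhds_of_eventually_within _ ?_ ?_
    · have : Filter.Tendsto (fun z : ℂ => z ^ (l : ℕ)) (𝓝 0) (𝓝 (0 ^ (l : ℕ))) :=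
        (continuous_pow _).tendsto _
      rw [zero_pow l.ne_zero] at this
      exact this.mono_left nhdsWithin_le_nhds
    · filter_upwards [self_mem_nhdsWithin] with z hz
      exact pow_ne_zero _ hz
  filter_upwards [ht.eventually hf] with z hz
  have hl : (l : ℤ) ≠ 0 := by exact_mod_cast l.ne_zero
  rw [← (mul_right_injective₀ hl).hasSum_iff]
  · refine hz.congr_fun ?_
    intro n
    simp [ramify_coeff_mul, zpow_mul]
  · intro n hn
    rw [ramify_coeff_of_not_dvd, zero_mul]
    rintro ⟨m, hm⟩
    exact hn ⟨m, hm.symm⟩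

lemma ramify_mem (k : BaseField) (l : ℕ+) {f : LaurentSeries ℂ} (hf : f ∈ k.toSubfield) :
    ramify l f ∈ k.toSubfield := by
  have hmero : ∀ (F : ℂ → ℂ) (z : ℂ), MeromorphicAt F (z ^ (l : ℕ)) →
      MeromorphicAt (fun z => F (z ^ (l : ℕ))) z := fun F z h =>
    MeromorphicAt.comp_analyticAt (f := F) (g := fun z => z ^ (l : ℕ)) h (by fun_prop)
  cases k with
  | meromorphic =>
    obtain ⟨F, hF, hf⟩ := hf
    exact ⟨_, fun z _ => hmero F z (hF _ (Set.mem_univ _)), hf.ramify l⟩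
  | convergent =>
    obtain ⟨F, hF, hf⟩ := hf
    refine ⟨_, fun z hz => hmero F z (hF _ ?_), hf.ramify l⟩
    rw [Set.mem_singleton_iff] at hz ⊢
    rw [hz, zero_pow l.ne_zero]
  | formal => trivial

/-- The ramified extension `K_l`: the field of the same kind as `K`, in the variable `z_l` with
`z_l ^ l = z`. As a field it is a copy of `K`; it is a `K`-algebra through `f(z) ↦ f(z_l ^ l)`. -/
def Ramified (k : BaseField) (_l : ℕ+) : Type := k.K

instance (k : BaseField) (l : ℕ+) : Field (Ramified k l) := inferInstanceAs (Field k.K)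

/-- The embedding `K → K_l`, `f(z) ↦ f(z_l ^ l)`. -/
def toRamified (k : BaseField) (l : ℕ+) : k.K →+* Ramified k l :=
  ((ramify l).comp k.toSubfield.subtype).codRestrict k.toSubfield (fun f => ramify_mem k l f.2)

instance (k : BaseField) (l : ℕ+) : Algebra k.K (Ramified k l) := (toRamified k l).toAlgebra

/-- The `z_l`-adic valuation on `K_l`. -/
def Ramified.v₀ {k : BaseField} {l : ℕ+} (a : Ramified k l) : ℤ :=
  BaseField.v₀ (k := k) a

/-- The compatible roots `q_l = exp(-2iπτ/l)`. -/
def qRoot (τ : ℂ) (l : ℕ+) : ℂˣ :=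
  Units.mk0 (Complex.exp (-2 * Complex.I * Real.pi * τ / (l : ℕ))) (Complex.exp_ne_zero _)

/-- The number `q = exp(-2iπτ)`. -/
abbrev qOf (τ : ℂ) : ℂˣ := qRoot τ 1

lemma qRoot_pow (τ : ℂ) (l : ℕ+) : qRoot τ l ^ (l : ℕ) = qOf τ := by
  have hl : ((l : ℕ) : ℂ) ≠ 0 := by exact_mod_cast l.ne_zero
  ext
  simp only [qOf, qRoot, Units.val_pow_eq_pow_val, Units.val_mk0, ← Complex.exp_nat_mul]
  congr 1
  field_simp
  simp

/-- The automorphism `σ_{q_l} : f(z_l) ↦ f(q_l z_l)` of `K_l`. -/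
def sigmaRamified (k : BaseField) (τ : ℂ) (l : ℕ+) : Ramified k l ≃+* Ramified k l :=
  sigma k (qRoot τ l)

lemma sigmaRamified_algebraMap (k : BaseField) (τ : ℂ) (l : ℕ+) (f : k.K) :
    sigmaRamified k τ l (algebraMap k.K (Ramified k l) f) =
      algebraMap k.K (Ramified k l) (sigma k (qOf τ) f) := by
  apply Subtype.ext
  change dilate (qRoot τ l) (ramify l f) = ramify l (dilate (qOf τ) f)
  ext n
  rw [dilate_coeff]
  by_cases h : (l : ℤ) ∣ n
  · obtain ⟨m, rfl⟩ := h
    rw [ramify_coeff_mul, ramify_coeff_mul, dilate_coeff, ← qRoot_pow τ l, zpow_mul]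
    simp
  · rw [ramify_coeff_of_not_dvd _ _ _ h, ramify_coeff_of_not_dvd _ _ _ h, mul_zero]

/-! ### Difference modules over a difference field

Over a difference field `(K, σ)`, a difference module is a finite-dimensional `K`-vector space `M`
with a `σ`-linear automorphism `Φ : M ≃ₛₗ[σ] M`. -/

section DifferenceModules

variable {K : Type*} [Field K] {σ : K ≃+* K}
  {M : Type*} [AddCommGroup M] [Module K M] {N : Type*} [AddCommGroup N] [Module K N]

/-- The tensor product `(M ⊗ N, x ⊗ y ↦ Φ x ⊗ Ψ y)`. -/
def tensorAut (Φ : M ≃ₛₗ[(σ : K →+* K)] M) (Ψ : N ≃ₛₗ[(σ : K →+* K)] N) :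
    (M ⊗[K] N) ≃ₛₗ[(σ : K →+* K)] (M ⊗[K] N) :=
  TensorProduct.congr Φ Ψ

@[simp] lemma tensorAut_tmul (Φ : M ≃ₛₗ[(σ : K →+* K)] M) (Ψ : N ≃ₛₗ[(σ : K →+* K)] N)
    (x : M) (y : N) : tensorAut Φ Ψ (x ⊗ₜ y) = Φ x ⊗ₜ Ψ y := rfl

/-- The dual `Hom(M, 1)`, where `1 = (K, σ)`, with `u ↦ σ ∘ u ∘ Φ⁻¹`. -/
def dualAut (Φ : M ≃ₛₗ[(σ : K →+* K)] M) :
    Module.Dual K M ≃ₛₗ[(σ : K →+* K)] Module.Dual K M where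
  toFun u :=
    { toFun := fun x => σ (u (Φ.symm x))
      map_add' := fun x y => by simp
      map_smul' := fun c x => by simp [map_smulₛₗ] }
  invFun u :=
    { toFun := fun x => σ.symm (u (Φ x))
      map_add' := fun x y => by simp
      map_smul' := fun c x => by simp [map_smulₛₗ] }
  left_inv u := by ext x; simp
  right_inv u := by ext x; simp
  map_add' u v := by ext x; simp
  map_smul' c u := by ext x; simp

@[simp] lemma dualAut_apply (Φ : M ≃ₛₗ[(σ : K →+* K)] M) (u : Module.Dual K M) (x : M) :
    dualAut Φ u x = σ (u (Φ.symm x)) := rfl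

/-- The extension of scalars `(L ⊗ M, a ⊗ x ↦ ρ a ⊗ Φ x)` of a difference module along an
extension of difference fields `(K, σ) → (L, ρ)`. -/
def baseChangeAut {L : Type*} [Field L] [Algebra K L] (ρ : L ≃+* L)
    (hρ : ∀ c : K, ρ (algebraMap K L c) = algebraMap K L (σ c)) (Φ : M ≃ₛₗ[(σ : K →+* K)] M) :
    (L ⊗[K] M) ≃ₛₗ[(ρ : L →+* L)] (L ⊗[K] M) :=
  let ρ' : L ≃ₛₗ[(σ : K →+* K)] L :=
    { ρ.toAddEquiv with
      map_smul' := fun c x => by simp [Algebra.smul_def, hρ] }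
  let e := TensorProduct.congr ρ' Φ
  { e.toAddEquiv with
    map_smul' := fun a t => by
      change e (a • t) = ρ a • e t
      induction t with
      | zero => simp
      | add x y hx hy => rw [smul_add, map_add, map_add, smul_add, hx, hy]
      | tmul b x =>
        rw [TensorProduct.smul_tmul', TensorProduct.congr_tmul, TensorProduct.congr_tmul,
          TensorProduct.smul_tmul', smul_eq_mul, smul_eq_mul]
        congr 1
        exact map_mul ρ a b }

@[simp] lemma baseChangeAut_tmul {L : Type*} [Field L] [Algebra K L] (ρ : L ≃+* L)
    (hρ : ∀ c : K, ρ (algebraMap K L c) = algebraMap K L (σ c)) (Φ : M ≃ₛₗ[(σ : K →+* K)] M)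
    (b : L) (x : M) : baseChangeAut ρ hρ Φ (b ⊗ₜ x) = ρ b ⊗ₜ Φ x := rfl

/-- A triangularisation of `(M, Φ)`: a filtration `0 = F₀ ⊂ F₁ ⊂ ⋯ ⊂ F_n = M` by difference
submodules such that each `F_{i+1} / F_i` is of rank one and isomorphic to `D / D (σ - a_i)`,
i.e. spanned by the class of a vector `e` with `Φ e ≡ a_i e` modulo `F_i`. -/
structure IsTriangularisation (Φ : M ≃ₛₗ[(σ : K →+* K)] M) {n : ℕ}
    (F : Fin (n + 1) → Submodule K M) (a : Fin n → K) : Prop where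
  bot : F 0 = ⊥
  top : F (Fin.last n) = ⊤
  stable : ∀ i, ∀ x ∈ F i, Φ x ∈ F i
  step : ∀ i : Fin n, ∃ e : M, e ∉ F i.castSucc ∧ F i.succ = F i.castSucc ⊔ Submodule.span K {e} ∧
    Φ e - a i • e ∈ F i.castSucc

end DifferenceModules

/-! ### The Newton function and the Newton polygon of a `q`-difference module -/

section Newton

variable {k : BaseField} {τ : ℂ} {M : Type*} [AddCommGroup M] [Module k.K M]

/-- `r` is a Newton function of `(M, Φ)`: for some ramification level `l`, the module
`K_l ⊗ M` has a triangularisation with rank one quotients `D / D (σ - a_i)`, and `r` is the sum of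
the Kronecker functions at the slopes `v₀(a_i) / l`. -/
def IsNewtonFunction (Φ : M ≃ₛₗ[(sigma k (qOf τ) : k.K →+* k.K)] M) (r : ℚ →₀ ℕ) : Prop :=
  ∃ (l : ℕ+) (n : ℕ) (F : Fin (n + 1) → Submodule (Ramified k l) (Ramified k l ⊗[k.K] M))
    (a : Fin n → Ramified k l),
    IsTriangularisation
      (baseChangeAut (sigmaRamified k τ l) (sigmaRamified_algebraMap k τ l) Φ) F a ∧
    r = ∑ i, Finsupp.single (((a i).v₀ : ℚ) / (l : ℕ)) 1

open Classical in
/-- The Newton function `r_M : ℚ → ℕ` of `(M, Φ)`. -/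
def newtonFunction (Φ : M ≃ₛₗ[(sigma k (qOf τ) : k.K →+* k.K)] M) : ℚ →₀ ℕ :=
  if h : ∃ r, IsNewtonFunction Φ r then h.choose else 0

end Newton

/-- The polygon with Newton function `r`, its left end placed at the origin: the convex hull of the
vertical half-lines going up from the vertices
`(∑_{μ < t} r(μ), ∑_{μ < t} r(μ) μ)`, `t ∈ ℚ`. Its lower boundary is made of the vectors
`(r(μ), r(μ) μ)`, in increasing order of the slopes `μ`. -/
def polygon (r : ℚ →₀ ℕ) : Set (ℝ × ℝ) :=
  convexHull ℝ {p | ∃ t : ℚ, p.1 = ∑ μ ∈ r.support with μ < t, (r μ : ℝ) ∧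
    ∑ μ ∈ r.support with μ < t, (r μ : ℝ) * (μ : ℝ) ≤ p.2}

end QDiff

end

open QDiff

/-! The slopes of a module are the valuations of the successive eigenvalues along a flag of
difference submodules over some `K_l`. The theorem rests on three facts: such a flag exists after
ramification, its multiset of slopes is unique, and flags can be built naturally for extensions,
tensor products and duals.

Existence (`exists_slopeChain`) is by induction on the dimension, by finding an eigenvector and
dividing by it. Let `T = Φ⁻¹` and take the first linear dependence in the orbit of a nonzero vector
under `T`. Its coefficients have a Newton polygon. After adjoining a suitable root of `z`,
multiplying `T` by a monomial of extremal slope makes all coefficients integral and at least one of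
them a unit. An eigenvector of the twisted operator then amounts to a solution of a scalar equation
`y = ∑ w ^ j G_j(z) y(q ^ (-j) z)`. The free constant `w` is taken to be a root of smallest modulus
of the characteristic equation at order zero. Since `|q⁻¹| < 1`, that equation has no root `w q ^
(-m)` with `m > 0`, so the coefficients of `y` are determined recursively and grow at most
geometrically (`exists_formal_solution`). For `ℳ(ℂ)` the equation itself continues `y` to the whole
plane, because its right side uses only values of `y` at points closer to `0`
(`mem_meromorphic_of_equation`).

Uniqueness is Jordan–Hölder (`IsTriangularisation.map_val_eq`). A generator of a rank one module
determines its eigenvalue only up to a factor `σ(c) / c`, which has valuation `0`. Two levels `l`,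
`l'` are compared over `K_{l l'}`: the valuation is multiplied by the same integer as the
denominator of the slope, so slopes do not change (`HasSlopes.mul_right`, `HasSlopes.unique`).

The algebraic operations are performed on flags: concatenation for exact sequences, annihilators for
duals, products of flags for tensor products. The relation `SlopeChain` joins two arbitrary
submodules, so that such pieces can be composed.

For Minkowski sums, a polygon is described by its length and the maxima of `t x - y` on it, `t ∈ ℚ`.
Both are additive in the Newton function (`mem_polygon_iff`, `polygon_add`). -/

noncomputable section

namespace QDiff

/-! ### Chains of difference submodules with rank one quotients -/

section Chains

variable {K : Type*} [Field K] {M : Type*} [AddCommGroup M] [Module K M]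
  {N : Type*} [AddCommGroup N] [Module K N] {Γ : Type*}

/-- A functional vanishing on a submodule and equal to `1` at a given vector outside of it. -/
lemma exists_dual_eq_one {A : Submodule K M} {e : M} (he : e ∉ A) :
    ∃ u : Module.Dual K M, u e = 1 ∧ ∀ x ∈ A, u x = 0 := by
  obtain ⟨u, hue, huA⟩ := Submodule.exists_dual_map_eq_bot_of_notMem he inferInstance
  refine ⟨(u e)⁻¹ • u, by simp [hue], fun x hx => ?_⟩
  have : u x ∈ A.map u := Submodule.mem_map_of_mem hx
  rw [huA, Submodule.mem_bot] at this
  simp [this]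

/-- Adjoining to a stable submodule a vector spanning a rank one quotient gives a stable
submodule. -/
lemma apply_mem_sup_span {Φ : M → M} {σ : K → K} {A : Submodule K M} {e : M} {a : K}
    (hadd : ∀ x y, Φ (x + y) = Φ x + Φ y)
    (hsmul : ∀ (c : K) x, Φ (c • x) = σ c • Φ x) (hΦ : Φ e - a • e ∈ A)
    (hA : ∀ x ∈ A, Φ x ∈ A) (x : M) (hx : x ∈ A ⊔ Submodule.span K {e}) :
    Φ x ∈ A ⊔ Submodule.span K {e} := by
  obtain ⟨y, hy, c, hc, rfl⟩ := Submodule.mem_sup.mp hx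
  obtain ⟨d, rfl⟩ := Submodule.mem_span_singleton.mp hc
  have : Φ (y + d • e) = (Φ y + σ d • (Φ e - a • e)) + (σ d * a) • e := by
    rw [hadd, hsmul, smul_sub, smul_smul]
    abel
  rw [this]
  exact Submodule.add_mem_sup (add_mem (hA y hy) (Submodule.smul_mem _ _ hΦ))
    (Submodule.smul_mem _ _ (Submodule.mem_span_singleton_self _))

/-- `SlopeChain val Φ A B S`: the submodule `B` is reached from `A` by successively adjoining
vectors `e` with `Φ e ≡ a e`, `a ≠ 0`, and `S` is the multiset of the values `val a`. -/
inductive SlopeChain (val : K → Γ) (Φ : M → M) :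
    Submodule K M → Submodule K M → Multiset Γ → Prop
  | refl (A : Submodule K M) : SlopeChain val Φ A A 0
  | step {A B : Submodule K M} {S : Multiset Γ} (e : M) (a : K) (he : e ∉ A) (ha : a ≠ 0)
      (hΦ : Φ e - a • e ∈ A) (h : SlopeChain val Φ (A ⊔ Submodule.span K {e}) B S) :
      SlopeChain val Φ A B (val a ::ₘ S)

namespace SlopeChain

variable {val : K → Γ} {Φ : M → M} {Ψ : N → N} {A B C : Submodule K M} {S T : Multiset Γ}

lemma single (e : M) (a : K) (he : e ∉ A) (ha : a ≠ 0) (hΦ : Φ e - a • e ∈ A) :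
    SlopeChain val Φ A (A ⊔ Submodule.span K {e}) {val a} :=
  step e a he ha hΦ (refl _)

lemma trans (h : SlopeChain val Φ A B S) (h' : SlopeChain val Φ B C T) :
    SlopeChain val Φ A C (S + T) := by
  induction h with
  | refl A => simpa using h'
  | step e a he ha hΦ _ ih =>
    rw [Multiset.cons_add]
    exact step e a he ha hΦ (ih h')

lemma map_val {Γ' : Type*} {val' : K → Γ'} (f : Γ → Γ') (hf : ∀ a, a ≠ 0 → val' a = f (val a))
    (h : SlopeChain val Φ A B S) : SlopeChain val' Φ A B (S.map f) := by
  induction h with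
  | refl A => exact refl A
  | step e a he ha hΦ _ ih =>
    rw [Multiset.map_cons, ← hf a ha]
    exact step e a he ha hΦ ih

lemma map (f : M →ₗ[K] N) (hf : Function.Injective f) (hfΦ : ∀ x, f (Φ x) = Ψ (f x))
    (h : SlopeChain val Φ A B S) : SlopeChain val Ψ (A.map f) (B.map f) S := by
  induction h with
  | refl A => exact refl _
  | step e a he ha hΦ _ ih =>
    refine step (f e) a ?_ ha ?_ ?_
    · rintro ⟨x, hx, hxe⟩
      exact he (hf hxe ▸ hx)
    · rw [← hfΦ, ← map_smul, ← map_sub]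
      exact Submodule.mem_map_of_mem hΦ
    · rwa [Submodule.map_sup, Submodule.map_span, Set.image_singleton] at ih

/-- Any lift of a step vector is a step vector, since membership in a preimage is tested after
applying `g`. The preimages contain the kernel of `g`, so one lift suffices to reach the next
preimage. -/
lemma comap {A B : Submodule K N} (g : M →ₗ[K] N) (hg : Function.Surjective g)
    (hgΦ : ∀ x, g (Φ x) = Ψ (g x)) (h : SlopeChain val Ψ A B S) :
    SlopeChain val Φ (A.comap g) (B.comap g) S := by
  induction h with
  | refl A => exact refl _
  | @step A B S e a he ha hΦ _ ih =>
    obtain ⟨e, rfl⟩ := hg e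
    refine step e a he ha ?_ ?_
    · rwa [Submodule.mem_comap, map_sub, map_smul, hgΦ]
    · convert ih using 1
      refine le_antisymm (sup_le (Submodule.comap_mono le_sup_left) ?_) ?_
      · rw [Submodule.span_singleton_le_iff_mem, Submodule.mem_comap]
        exact Submodule.mem_sup_right (Submodule.mem_span_singleton_self _)
      · intro x hx
        obtain ⟨y, hy, c, hc⟩ := Submodule.mem_sup.mp (Submodule.mem_comap.mp hx)
        obtain ⟨⟨d, rfl⟩, hc⟩ := (And.imp_left Submodule.mem_span_singleton.mp hc)
        refine Submodule.mem_sup.mpr ⟨x - d • e, ?_, d • e,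
          Submodule.smul_mem _ _ (Submodule.mem_span_singleton_self _), by simp⟩
        rw [Submodule.mem_comap, map_sub, map_smul, ← hc, add_sub_cancel_right]
        exact hy

end SlopeChain

variable {σ : K ≃+* K}

/-- A stable submodule of a difference module is also stable under `Φ⁻¹`. -/
lemma mem_of_apply_mem [FiniteDimensional K M] (Φ : M ≃ₛₗ[(σ : K →+* K)] M) {A : Submodule K M}
    (hA : ∀ x ∈ A, Φ x ∈ A) {x : M} (hx : Φ x ∈ A) : x ∈ A := by
  have hle : A ≤ A.comap (Φ : M →ₛₗ[(σ : K →+* K)] M) := hA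
  let f : ℕ → Submodule K M := fun n => (Submodule.comap (Φ : M →ₛₗ[(σ : K →+* K)] M))^[n] A
  have hf : Monotone f := by
    refine monotone_nat_of_le_succ fun n => ?_
    induction n with
    | zero => exact hle
    | succ n ih =>
      simp only [f, Function.iterate_succ_apply'] at ih ⊢
      exact Submodule.comap_mono ih
  obtain ⟨n, hn⟩ := monotone_stabilizes_iff_noetherian.mpr
    (inferInstance : IsNoetherian K M) ⟨f, hf⟩
  have hn : f n = f (n + 1) := hn (n + 1) n.le_succ
  have hmem : ∀ (n : ℕ) (y : M), y ∈ f n ↔ Φ^[n] y ∈ A := by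
    intro n
    induction n with
    | zero => intro y; rfl
    | succ n ih =>
      intro y
      rw [Function.iterate_succ_apply, ← ih]
      simp only [f, Function.iterate_succ_apply']
      rfl
  -- `f n` is the preimage of `A` under `Φ^n`, and the increasing sequence is stationary at `n`.
  -- With `x = Φ^n y`, the hypothesis puts `y` in `f (n + 1) = f n`, which is the claim.
  obtain ⟨y, rfl⟩ := Φ.surjective.iterate n x
  rw [← hmem, hn, hmem, Function.iterate_succ_apply']
  exact hx

/-! ### Jordan–Hölder uniqueness of the slopes -/

namespace IsTriangularisation

variable {Φ : M ≃ₛₗ[(σ : K →+* K)] M} {n : ℕ} {F : Fin (n + 1) → Submodule K M} {a : Fin n → K}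

lemma monotone (h : IsTriangularisation Φ F a) : Monotone F := by
  refine Fin.monotone_iff_le_succ.mpr fun i => ?_
  obtain ⟨e, -, hF, -⟩ := h.step i
  rw [hF]
  exact le_sup_left

/-- A zero eigenvalue would give `Φ e ∈ F i.castSucc`, and this submodule is also stable under
`Φ⁻¹`, so it would contain `e`. -/
lemma ne_zero [FiniteDimensional K M] (h : IsTriangularisation Φ F a) (i : Fin n) : a i ≠ 0 := by
  obtain ⟨e, he, -, hΦ⟩ := h.step i
  intro ha
  rw [ha, zero_smul, sub_zero] at hΦ
  exact he (mem_of_apply_mem Φ (h.stable _) hΦ)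

lemma slopeChain [FiniteDimensional K M] (h : IsTriangularisation Φ F a) (val : K → Γ) :
    SlopeChain val Φ ⊥ ⊤ (Finset.univ.val.map fun i => val (a i)) := by
  have key : ∀ (m : ℕ) (hm : m ≤ n), SlopeChain val Φ (F 0) (F ⟨m, by omega⟩)
      (Finset.univ.val.map fun i : Fin m => val (a (Fin.castLE hm i))) := by
    intro m
    induction m with
    | zero => intro _; exact SlopeChain.refl _
    | succ m ih =>
      intro hm
      obtain ⟨e, he, hF, hΦ⟩ := h.step ⟨m, hm⟩
      have h1 := (ih (by omega)).trans (SlopeChain.single (val := val) e _ he (h.ne_zero _) hΦ)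
      have hF' : F ⟨m + 1, by omega⟩ = F ⟨m, by omega⟩ ⊔ Submodule.span K {e} := hF
      -- The multiset is rewritten as a sum of singletons over `Fin (m + 1)`, so that the last index
      -- can be split off.
      have h2 : (Finset.univ.val.map fun i : Fin (m + 1) => val (a (Fin.castLE hm i))) =
          (Finset.univ.val.map fun i : Fin m => val (a (Fin.castLE (by omega) i))) +
            {val (a ⟨m, hm⟩)} := by
        have := Fin.sum_univ_castSucc (fun i : Fin (m + 1) => ({val (a (Fin.castLE hm i))} :
          Multiset Γ))
        rw [Finset.sum_eq_multiset_sum, Finset.sum_eq_multiset_sum] at this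
        have hs : ∀ (p : ℕ) (f : Fin p → Γ), (Finset.univ.val.map fun i => ({f i} : Multiset Γ)).sum
            = Finset.univ.val.map f := by
          intro p f
          have := Multiset.map_map (fun x => ({x} : Multiset Γ)) f Finset.univ.val
          rw [Function.comp_def] at this
          rw [← this, Multiset.sum_map_singleton]
        rw [hs, hs] at this
        exact this
      rw [h2, hF']
      exact h1
  have := key n le_rfl
  rw [h.bot] at this
  have htop : F ⟨n, by omega⟩ = ⊤ := h.top
  rw [htop] at this
  exact this

/-- The vector `x` witnesses that the `i`-th step of one chain matches the `j`-th step of the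
other one. -/
def Matches {n n' : ℕ} (F : Fin (n + 1) → Submodule K M) (F' : Fin (n' + 1) → Submodule K M)
    (i : Fin n) (j : Fin n') : Prop :=
  ∃ x ∈ F i.succ ⊓ F' j.succ, x ∉ (F i.succ ⊓ F' j.castSucc) ⊔ (F i.castSucc ⊓ F' j.succ)

lemma Matches.symm {n n' : ℕ} {F : Fin (n + 1) → Submodule K M}
    {F' : Fin (n' + 1) → Submodule K M} {i : Fin n} {j : Fin n'} (h : Matches F F' i j) :
    Matches F' F j i := by
  obtain ⟨x, hx, hx'⟩ := h
  refine ⟨x, inf_comm (F i.succ) _ ▸ hx, ?_⟩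
  rwa [sup_comm, inf_comm (F' j.succ), inf_comm (F' j.castSucc)]

variable {n' : ℕ} {F' : Fin (n' + 1) → Submodule K M} {a' : Fin n' → K}

/-- Take the least `j` for which `F' j` meets `F i.succ` outside `F i.castSucc`; it is not `0` since
`F' 0 = ⊥`. Were the vector found there a sum as excluded by `Matches`, its component in the smaller
term of `F'` would still lie outside `F i.castSucc`, against minimality. -/
lemma exists_matches (h : IsTriangularisation Φ F a) (h' : IsTriangularisation Φ F' a')
    (i : Fin n) : ∃ j, Matches F F' i j := by
  classical
  obtain ⟨e, he, hF, -⟩ := h.step i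
  have hex : ∃ j : Fin (n' + 1), ∃ x ∈ F i.succ ⊓ F' j, x ∉ F i.castSucc :=
    ⟨Fin.last _, e, ⟨hF ▸ Submodule.mem_sup_right (Submodule.mem_span_singleton_self e),
      h'.top ▸ Submodule.mem_top⟩, he⟩
  obtain ⟨j, ⟨x, hx, hxi⟩, hmin⟩ := WellFounded.has_min (wellFounded_lt (α := Fin (n' + 1)))
    {j | ∃ x ∈ F i.succ ⊓ F' j, x ∉ F i.castSucc} hex
  induction j using Fin.cases with
  | zero =>
    have : x ∈ F' 0 := hx.2
    rw [h'.bot, Submodule.mem_bot] at this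
    exact absurd (this ▸ Submodule.zero_mem _) hxi
  | succ j =>
    refine ⟨j, x, hx, fun hx2 => ?_⟩
    obtain ⟨u, hu, w, hw, rfl⟩ := Submodule.mem_sup.mp hx2
    refine hmin j.castSucc ⟨u, hu, fun hu' => hxi (add_mem hu' hw.1)⟩ ?_
    exact Fin.castSucc_lt_succ

/-- The quotient `F i.succ / F i.castSucc` is a line generated by the witness `x` for `j`, so the
witness `y` for `j'` is a multiple of `x` modulo `F i.castSucc`. If `j < j'`, that multiple already
lies in `F' j'.castSucc`, and `y` is an excluded sum. -/
lemma matches_not_lt (h : IsTriangularisation Φ F a) (h' : IsTriangularisation Φ F' a')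
    {i : Fin n} {j j' : Fin n'} (hj : Matches F F' i j) (hj' : Matches F F' i j') : ¬ j < j' := by
  intro hlt
  obtain ⟨x, hx, hx2⟩ := hj
  obtain ⟨y, hy, hy2⟩ := hj'
  have hxi : x ∉ F i.castSucc := fun hxi => hx2 (Submodule.mem_sup_right ⟨hxi, hx.2⟩)
  obtain ⟨e, he, hF, -⟩ := h.step i
  have hx1 : x ∈ F i.castSucc ⊔ Submodule.span K {e} := hF ▸ hx.1
  have hy1 : y ∈ F i.castSucc ⊔ Submodule.span K {e} := hF ▸ hy.1
  obtain ⟨u, hu, c, hc, rfl⟩ := Submodule.mem_sup.mp hx1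
  obtain ⟨c, rfl⟩ := Submodule.mem_span_singleton.mp hc
  obtain ⟨w, hw, d, hd, rfl⟩ := Submodule.mem_sup.mp hy1
  obtain ⟨d, rfl⟩ := Submodule.mem_span_singleton.mp hd
  have hc0 : c ≠ 0 := by
    rintro rfl
    apply hxi
    simpa using hu
  have hle : F' j.succ ≤ F' j'.castSucc := h'.monotone (by
    rw [Fin.succ_le_castSucc_iff]; exact hlt)
  have hxj : (d / c) • (u + c • e) ∈ F i.succ ⊓ F' j'.castSucc :=
    Submodule.smul_mem _ _ ⟨hx.1, hle hx.2⟩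
  have hdiff : w + d • e - (d / c) • (u + c • e) = w - (d / c) • u := by
    rw [smul_add, smul_smul, div_mul_cancel₀ _ hc0]
    abel
  refine hy2 (Submodule.mem_sup.mpr ⟨_, hxj, _, ⟨?_, ?_⟩, add_sub_cancel _ _⟩)
  · rw [hdiff]
    exact sub_mem hw (Submodule.smul_mem _ _ hu)
  · exact sub_mem hy.2 (h'.monotone (Fin.castSucc_lt_succ).le hxj.2)

lemma matches_unique (h : IsTriangularisation Φ F a) (h' : IsTriangularisation Φ F' a')
    {i : Fin n} {j j' : Fin n'} (hj : Matches F F' i j) (hj' : Matches F F' i j') : j = j' :=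
  le_antisymm (not_lt.mp (h.matches_not_lt h' hj' hj)) (not_lt.mp (h.matches_not_lt h' hj hj'))

/-- `Φ x ≡ a x` at a vector of a rank one quotient determines `a` up to `σ(c) / c`. -/
lemma exists_apply_sub_mem (h : IsTriangularisation Φ F a) {i : Fin n} {x : M}
    (hx : x ∈ F i.succ) (hxi : x ∉ F i.castSucc) :
    ∃ c : K, c ≠ 0 ∧ Φ x - (a i * (σ c / c)) • x ∈ F i.castSucc := by
  obtain ⟨e, he, hF, hΦ⟩ := h.step i
  rw [hF] at hx
  obtain ⟨u, hu, c, hc, rfl⟩ := Submodule.mem_sup.mp hx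
  obtain ⟨c, rfl⟩ := Submodule.mem_span_singleton.mp hc
  have hc0 : c ≠ 0 := by
    rintro rfl
    apply hxi
    simpa using hu
  refine ⟨c, hc0, ?_⟩
  have : Φ (u + c • e) - (a i * (σ c / c)) • (u + c • e) =
      Φ u + σ c • (Φ e - a i • e) - (a i * (σ c / c)) • u := by
    have h1 : (a i * (σ c / c)) • c • e = σ c • a i • e := by
      rw [smul_smul, smul_smul]
      congr 1
      field_simp
    rw [map_add, map_smulₛₗ, smul_add, h1, smul_sub]
    simp only [RingHom.coe_coe]
    abel
  rw [this]
  exact sub_mem (add_mem (h.stable _ u hu) (Submodule.smul_mem _ _ hΦ)) (Submodule.smul_mem _ _ hu)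

/-- A matching vector `x` satisfies `Φ x ≡ b x` modulo one flag and `Φ x ≡ b' x` modulo the other.
Subtracting puts `(b' - b) x` in the sum excluded by `Matches`, so `b = b'`. Since `b` and `b'`
differ from `a i` and `a' j` only by factors `σ c / c`, which `val` ignores, the values agree. -/
lemma val_eq_of_matches (h : IsTriangularisation Φ F a) (h' : IsTriangularisation Φ F' a')
    {val : K → Γ} (hval : ∀ a c : K, c ≠ 0 → val (a * (σ c / c)) = val a)
    {i : Fin n} {j : Fin n'} (hij : Matches F F' i j) : val (a i) = val (a' j) := by
  obtain ⟨x, hx, hx2⟩ := hij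
  obtain ⟨c, hc, h1⟩ := h.exists_apply_sub_mem hx.1
    fun hxi => hx2 (Submodule.mem_sup_right ⟨hxi, hx.2⟩)
  obtain ⟨d, hd, h2⟩ := h'.exists_apply_sub_mem hx.2
    fun hxj => hx2 (Submodule.mem_sup_left ⟨hx.1, hxj⟩)
  rw [← hval (a i) c hc, ← hval (a' j) d hd]
  set b := a i * (σ c / c)
  set b' := a' j * (σ d / d)
  by_contra hne
  have hb : b' - b ≠ 0 := fun h0 => hne (by rw [sub_eq_zero.mp h0])
  have e1 : Φ x - b • x ∈ F i.castSucc ⊓ F' j.succ :=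
    ⟨h1, sub_mem (h'.stable _ _ hx.2) (Submodule.smul_mem _ _ hx.2)⟩
  have e2 : Φ x - b' • x ∈ F i.succ ⊓ F' j.castSucc :=
    ⟨sub_mem (h.stable _ _ hx.1) (Submodule.smul_mem _ _ hx.1), h2⟩
  have e3 : (b' - b) • x ∈ (F i.succ ⊓ F' j.castSucc) ⊔ (F i.castSucc ⊓ F' j.succ) := by
    have : (b' - b) • x = (Φ x - b • x) - (Φ x - b' • x) := by
      rw [sub_smul]; abel
    rw [this]
    exact sub_mem (Submodule.mem_sup_right e1) (Submodule.mem_sup_left e2)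
  exact hx2 ((Submodule.smul_mem_iff _ hb).mp e3)

/-- Jordan–Hölder: the multiset of the values of the `a i` does not depend on the
triangularisation. -/
theorem map_val_eq (h : IsTriangularisation Φ F a) (h' : IsTriangularisation Φ F' a')
    {val : K → Γ} (hval : ∀ a c : K, c ≠ 0 → val (a * (σ c / c)) = val a) :
    (Finset.univ.val.map fun i => val (a i)) = Finset.univ.val.map fun i => val (a' i) := by
  -- Matching is a relation with existence and uniqueness on both sides, hence the graph of a
  -- bijection.
  choose p hp using h.exists_matches h'
  choose p' hp' using h'.exists_matches h
  let e : Fin n ≃ Fin n' :=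
    { toFun := p
      invFun := p'
      left_inv := fun i => h'.matches_unique h (hp' (p i)) (hp i).symm
      right_inv := fun j => h.matches_unique h' (hp (p' j)) (hp' j).symm }
  rw [← Finset.map_univ_equiv e, Finset.map_val, Multiset.map_map]
  exact Multiset.map_congr rfl fun i _ => h.val_eq_of_matches h' hval (hp i)

end IsTriangularisation

/-! ### From chains back to filtrations; exact sequences, duals and tensor products of chains -/

lemma SlopeChain.exists_filtration {val : K → Γ} {Φ : M ≃ₛₗ[(σ : K →+* K)] M}
    {A B : Submodule K M} {S : Multiset Γ} (h : SlopeChain val Φ A B S)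
    (hA : ∀ x ∈ A, Φ x ∈ A) :
    ∃ (n : ℕ) (F : Fin (n + 1) → Submodule K M) (a : Fin n → K), F 0 = A ∧ F (Fin.last n) = B ∧
      (∀ i, ∀ x ∈ F i, Φ x ∈ F i) ∧
      (∀ i : Fin n, ∃ e : M, e ∉ F i.castSucc ∧ F i.succ = F i.castSucc ⊔ Submodule.span K {e} ∧
        Φ e - a i • e ∈ F i.castSucc) ∧ S = Finset.univ.val.map fun i => val (a i) := by
  induction h with
  | refl A => exact ⟨0, fun _ => A, Fin.elim0, rfl, rfl, fun _ => hA, fun i => i.elim0, rfl⟩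
  | @step A B S e a he ha hΦ _ ih =>
    obtain ⟨n, F, b, h0, hl, hst, hstep, rfl⟩ := ih (apply_mem_sup_span
      (map_add Φ) (map_smulₛₗ Φ) hΦ hA)
    refine ⟨n + 1, Fin.cons A F, Fin.cons a b, rfl, ?_, ?_, ?_, ?_⟩
    · rw [← Fin.succ_last, Fin.cons_succ, hl]
    · intro i
      induction i using Fin.cases with
      | zero => exact hA
      | succ i => exact hst i
    · intro i
      induction i using Fin.cases with
      | zero => exact ⟨e, he, h0, hΦ⟩
      | succ i => exact hstep i
    · rw [Fin.univ_succ]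
      simp [Function.comp_def]

lemma SlopeChain.exists_isTriangularisation {val : K → Γ} {Φ : M ≃ₛₗ[(σ : K →+* K)] M}
    {S : Multiset Γ} (h : SlopeChain val Φ ⊥ ⊤ S) :
    ∃ (n : ℕ) (F : Fin (n + 1) → Submodule K M) (a : Fin n → K), IsTriangularisation Φ F a ∧
      S = Finset.univ.val.map fun i => val (a i) := by
  obtain ⟨n, F, a, h0, hl, hst, hstep, hS⟩ := h.exists_filtration (by simp)
  exact ⟨n, F, a, ⟨h0, hl, hst, hstep⟩, hS⟩

/-- The multiset of slopes of a difference module is well defined. -/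
theorem SlopeChain.unique {val : K → Γ} {Φ : M ≃ₛₗ[(σ : K →+* K)] M} {S T : Multiset Γ}
    (hval : ∀ a c : K, c ≠ 0 → val (a * (σ c / c)) = val a)
    (h : SlopeChain val Φ ⊥ ⊤ S) (h' : SlopeChain val Φ ⊥ ⊤ T) : S = T := by
  obtain ⟨n, F, a, hF, rfl⟩ := h.exists_isTriangularisation
  obtain ⟨n', F', a', hF', rfl⟩ := h'.exists_isTriangularisation
  exact hF.map_val_eq hF' hval

/-- Slopes are additive in short exact sequences. -/
lemma SlopeChain.of_exact {P : Type*} [AddCommGroup P] [Module K P] {val : K → Γ}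
    {Φ' : M → M} {Φ : N → N} {Φ'' : P → P} (f : M →ₗ[K] N) (g : N →ₗ[K] P)
    (hf : Function.Injective f) (hfg : Function.Exact f g) (hg : Function.Surjective g)
    (hfΦ : ∀ x, f (Φ' x) = Φ (f x)) (hgΦ : ∀ x, g (Φ x) = Φ'' (g x)) {S' S'' : Multiset Γ}
    (h' : SlopeChain val Φ' ⊥ ⊤ S') (h'' : SlopeChain val Φ'' ⊥ ⊤ S'') :
    SlopeChain val Φ ⊥ ⊤ (S' + S'') := by
  have h1 := h'.map f hf hfΦ
  have h2 := h''.comap g hg hgΦ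
  rw [Submodule.map_bot, Submodule.map_top] at h1
  rw [Submodule.comap_top, Submodule.comap_bot, LinearMap.exact_iff.mp hfg] at h2
  exact h1.trans h2

/-- Slopes are invariant under isomorphism. -/
lemma SlopeChain.congr {val : K → Γ} {Φ : M → M} {Ψ : N → N} {S : Multiset Γ} (e : M ≃ₗ[K] N)
    (he : ∀ x, e (Φ x) = Ψ (e x)) (h : SlopeChain val Φ ⊥ ⊤ S) : SlopeChain val Ψ ⊥ ⊤ S := by
  have := h.map (e : M →ₗ[K] N) e.injective he
  rwa [Submodule.map_bot, Submodule.map_top, LinearEquiv.range] at this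

/-- The slopes of the dual are the opposites. -/
lemma SlopeChain.dual [FiniteDimensional K M] {val : K → Γ} {ν : Γ → Γ}
    (hν : ∀ a, a ≠ 0 → val a⁻¹ = ν (val a)) {Φ : M ≃ₛₗ[(σ : K →+* K)] M} {A B : Submodule K M}
    {S : Multiset Γ} (h : SlopeChain val Φ A B S) (hA : ∀ x ∈ A, Φ x ∈ A) :
    SlopeChain val (dualAut Φ) B.dualAnnihilator A.dualAnnihilator (S.map ν) := by
  induction h with
  | refl A => exact refl _
  | @step A B S e a he ha hΦ _ ih =>
    have ih := ih (apply_mem_sup_span (map_add Φ) (map_smulₛₗ Φ) hΦ hA)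
    -- Annihilators reverse the chain: the step from `A` to `B'` becomes a step from the annihilator
    -- of `B'` to that of `A`, generated by a functional that kills `A` and is `1` at `e`.
    obtain ⟨u, hue, huA'⟩ := exists_dual_eq_one he
    set B' := A ⊔ Submodule.span K {e}
    have hmem : ∀ w : Module.Dual K M, w ∈ B'.dualAnnihilator ↔ (∀ x ∈ A, w x = 0) ∧ w e = 0 := by
      intro w
      rw [Submodule.dualAnnihilator_sup_eq, Submodule.mem_inf, Submodule.mem_dualAnnihilator,
        Submodule.mem_dualAnnihilator]
      refine and_congr_right fun _ => ⟨fun h => h e (Submodule.mem_span_singleton_self e), ?_⟩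
      intro h x hx
      obtain ⟨c, rfl⟩ := Submodule.mem_span_singleton.mp hx
      rw [map_smul, h, smul_zero]
    have hsymm : ∀ x ∈ A, Φ.symm x ∈ A := fun x hx =>
      mem_of_apply_mem Φ hA (by simpa using hx)
    -- Applying `Φ⁻¹` to `Φ e - a e ∈ A` gives `e - σ⁻¹(a) Φ⁻¹ e ∈ A`; evaluating `u` and then `σ`
    -- gives the eigenvalue `a⁻¹`.
    have hue' : σ (u (Φ.symm e)) = a⁻¹ := by
      have h1 := huA' _ (hsymm _ hΦ)
      have h2 : Φ.symm (a • e) = σ.symm a • Φ.symm e := by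
        apply Φ.injective
        rw [map_smulₛₗ]
        simp
      rw [map_sub, LinearEquiv.symm_apply_apply, h2, map_sub, map_smul, sub_eq_zero] at h1
      have h3 := congrArg σ h1
      rw [hue, smul_eq_mul, map_mul, RingEquiv.apply_symm_apply, map_one] at h3
      exact eq_inv_of_mul_eq_one_right h3.symm
    rw [Multiset.map_cons, ← hν a ha, ← Multiset.singleton_add, add_comm]
    refine ih.trans ?_
    have h3 : A.dualAnnihilator = B'.dualAnnihilator ⊔ Submodule.span K {u} := by
      refine le_antisymm (fun w hw => ?_) (sup_le (Submodule.dualAnnihilator_anti le_sup_left) ?_)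
      · rw [Submodule.mem_dualAnnihilator] at hw
        refine Submodule.mem_sup.mpr ⟨w - w e • u, ?_, _, Submodule.smul_mem _ _
          (Submodule.mem_span_singleton_self _), sub_add_cancel _ _⟩
        rw [hmem]
        refine ⟨fun x hx => by simp [hw x hx, huA' x hx], by simp [hue]⟩
      · rw [Submodule.span_singleton_le_iff_mem, Submodule.mem_dualAnnihilator]
        exact huA'
    rw [h3]
    refine single u a⁻¹ (fun h => by simpa [hue] using ((hmem u).mp h).2) (inv_ne_zero ha) ?_
    rw [hmem]
    refine ⟨fun x hx => ?_, ?_⟩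
    · simp [huA' x hx, huA' _ (hsymm x hx)]
    · simp [hue', hue]

/-- The slopes of a tensor product are the sums of the slopes. -/
lemma SlopeChain.tensor_right {val : K → Γ} [Add Γ]
    (hmul : ∀ a b, a ≠ 0 → b ≠ 0 → val (a * b) = val a + val b)
    {Φ : M ≃ₛₗ[(σ : K →+* K)] M} {Ψ : N ≃ₛₗ[(σ : K →+* K)] N} {A : Submodule K M}
    {C D : Submodule K N} {S : Multiset Γ} {e : M} {a : K}
    (he : e ∉ A) (ha : a ≠ 0) (hΦ : Φ e - a • e ∈ A) (h : SlopeChain val Ψ C D S) :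
    SlopeChain val (tensorAut Φ Ψ)
      (Submodule.map₂ (TensorProduct.mk K M N) A ⊤ ⊔
        Submodule.map₂ (TensorProduct.mk K M N) (Submodule.span K {e}) C)
      (Submodule.map₂ (TensorProduct.mk K M N) A ⊤ ⊔
        Submodule.map₂ (TensorProduct.mk K M N) (Submodule.span K {e}) D)
      (S.map (val a + ·)) := by
  induction h with
  | refl A => exact refl _
  | @step C D S f b hf hb hΨ _ ih =>
    rw [Multiset.map_cons, ← hmul a b ha hb]
    refine step (e ⊗ₜ f) (a * b) ?_ (mul_ne_zero ha hb) ?_ ?_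
    · obtain ⟨u, hue, huA'⟩ := exists_dual_eq_one he
      obtain ⟨w, hwf, hwC'⟩ := exists_dual_eq_one hf
      -- The form `u ⊗ w` vanishes on `A ⊗ N` and on `e ⊗ C` but takes the value `1` at `e ⊗ f`,
      -- which therefore is a new vector.
      let p := TensorProduct.lift ((LinearMap.mul K K).compl₁₂ u w)
      have hp : ∀ x y, p (x ⊗ₜ y) = u x * w y := fun x y => rfl
      have hle : Submodule.map₂ (TensorProduct.mk K M N) A ⊤ ⊔
          Submodule.map₂ (TensorProduct.mk K M N) (Submodule.span K {e}) C ≤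
          LinearMap.ker p := by
        refine sup_le (Submodule.map₂_le.mpr fun x hx y _ => ?_)
          (Submodule.map₂_le.mpr fun x _ y hy => ?_)
        · rw [LinearMap.mem_ker, TensorProduct.mk_apply, hp, huA' x hx, zero_mul]
        · rw [LinearMap.mem_ker, TensorProduct.mk_apply, hp, hwC' y hy, mul_zero]
      intro hmem
      have := hle hmem
      rw [LinearMap.mem_ker, hp] at this
      simp [hue, hwf] at this
    · have : tensorAut Φ Ψ (e ⊗ₜ f) - (a * b) • e ⊗ₜ[K] f =
          (Φ e - a • e) ⊗ₜ Ψ f + (a • e) ⊗ₜ (Ψ f - b • f) := by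
        rw [tensorAut_tmul, TensorProduct.sub_tmul, TensorProduct.tmul_sub,
          TensorProduct.tmul_smul, TensorProduct.smul_tmul', TensorProduct.smul_tmul',
          smul_smul, mul_comm b a]
        abel
      rw [this]
      refine Submodule.add_mem_sup (Submodule.apply_mem_map₂ _ hΦ Submodule.mem_top)
        (Submodule.apply_mem_map₂ _ ?_ hΨ)
      exact Submodule.smul_mem _ _ (Submodule.mem_span_singleton_self e)
    · rw [Submodule.map₂_sup_right, ← sup_assoc, Submodule.map₂_span_span,
        Set.image2_singleton] at ih
      exact ih

/-- Each step of the first chain, with generator `e`, is refined by the complete second chain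
tensored with `e`. This contributes all sums of the slope of that step with slopes of `N`. -/
lemma SlopeChain.tensor {val : K → Γ} [Add Γ]
    (hmul : ∀ a b, a ≠ 0 → b ≠ 0 → val (a * b) = val a + val b)
    {Φ : M ≃ₛₗ[(σ : K →+* K)] M} {Ψ : N ≃ₛₗ[(σ : K →+* K)] N} {A B : Submodule K M}
    {S T : Multiset Γ} (h : SlopeChain val Φ A B S) (h' : SlopeChain val Ψ ⊥ ⊤ T) :
    SlopeChain val (tensorAut Φ Ψ)
      (Submodule.map₂ (TensorProduct.mk K M N) A ⊤)
      (Submodule.map₂ (TensorProduct.mk K M N) B ⊤)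
      (S.bind fun s => T.map (s + ·)) := by
  induction h with
  | refl A => exact refl _
  | @step A B S e a he ha hΦ _ ih =>
    rw [Multiset.cons_bind]
    refine SlopeChain.trans ?_ ih
    have := h'.tensor_right hmul he ha hΦ
    rwa [Submodule.map₂_bot_right, sup_bot_eq, ← Submodule.map₂_sup_left] at this

end Chains

/-! ### Extension of scalars along a homomorphism of fields -/

section ScalarExtension

variable {K L : Type*} [Field K] [Field L] {φ : K →+* L} {M : Type*} [AddCommGroup M] [Module K M]
  {V : Type*} [AddCommGroup V] [Module L V] {X : Type*} [AddCommGroup X] [Module L X]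

/-- The `φ`-linear map `ι : M → V` exhibits `V` as the extension of scalars of `M` along `φ`. -/
def IsScalarExtension (ι : M →ₛₗ[φ] V) : Prop :=
  ∀ ⦃n : ℕ⦄ (b : Module.Basis (Fin n) K M), ∃ b' : Module.Basis (Fin n) L V, ∀ i, b' i = ι (b i)

namespace IsScalarExtension

variable {ι : M →ₛₗ[φ] V}

/-- One basis suffices: the images of any other basis span `V` over `L` and have the right number of
elements. -/
lemma of_basis {n : ℕ} {b : Module.Basis (Fin n) K M} {b' : Module.Basis (Fin n) L V}
    (h : ∀ i, b' i = ι (b i)) : IsScalarExtension ι := by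
  intro m c
  obtain rfl : n = m := by
    simpa using (Module.finrank_eq_card_basis b).symm.trans (Module.finrank_eq_card_basis c)
  have hspan : ⊤ ≤ Submodule.span L (Set.range fun i => ι (c i)) := by
    rw [← b'.span_eq, Submodule.span_le]
    rintro _ ⟨i, rfl⟩
    rw [h, ← c.sum_repr (b i), map_sum]
    refine Submodule.sum_mem _ fun j _ => ?_
    rw [map_smulₛₗ]
    exact Submodule.smul_mem _ _ (Submodule.subset_span ⟨j, rfl⟩)
  have hfin : Fintype.card (Fin n) = Module.finrank L V := (Module.finrank_eq_card_basis b').symm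
  have : FiniteDimensional L V := b'.finiteDimensional_of_finite
  exact ⟨basisOfTopLeSpanOfCardEqFinrank _ hspan hfin, fun i => by simp⟩

lemma trans {L' : Type*} [Field L'] {φ' : L →+* L'} {φ'' : K →+* L'}
    {W : Type*} [AddCommGroup W] [Module L' W] {ι' : V →ₛₗ[φ'] W} {ι'' : M →ₛₗ[φ''] W}
    (h : IsScalarExtension ι) (h' : IsScalarExtension ι')
    (hι : ∀ x, ι'' x = ι' (ι x)) : IsScalarExtension ι'' := by
  intro n b
  obtain ⟨b', hb'⟩ := h b
  obtain ⟨b'', hb''⟩ := h' b'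
  exact ⟨b'', fun i => by rw [hb'', hb', hι]⟩

variable [FiniteDimensional K M]

lemma finiteDimensional (h : IsScalarExtension ι) : FiniteDimensional L V := by
  obtain ⟨b', -⟩ := h (Module.finBasis K M)
  exact b'.finiteDimensional_of_finite

lemma finrank_eq (h : IsScalarExtension ι) : Module.finrank L V = Module.finrank K M := by
  obtain ⟨b', -⟩ := h (Module.finBasis K M)
  rw [Module.finrank_eq_card_basis b', Fintype.card_fin]

lemma span_range (h : IsScalarExtension ι) : Submodule.span L (Set.range ι) = ⊤ := by
  obtain ⟨b', hb'⟩ := h (Module.finBasis K M)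
  rw [eq_top_iff, ← b'.span_eq]
  refine Submodule.span_mono ?_
  rintro _ ⟨i, rfl⟩
  exact ⟨_, (hb' i).symm⟩

/-- The universal property of the extension of scalars. -/
lemma exists_lift (h : IsScalarExtension ι) (f : M →ₛₗ[φ] X) :
    ∃ g : V →ₗ[L] X, ∀ x, g (ι x) = f x := by
  obtain ⟨b', hb'⟩ := h (Module.finBasis K M)
  refine ⟨b'.constr ℕ fun i => f (Module.finBasis K M i), fun x => ?_⟩
  conv_lhs => rw [← (Module.finBasis K M).sum_repr x]
  conv_rhs => rw [← (Module.finBasis K M).sum_repr x]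
  simp only [map_sum, map_smulₛₗ, ← hb', Module.Basis.constr_basis, RingHom.id_apply]

/-- Two `ρ`-linear maps which agree on `M` are equal. -/
lemma ext_of_semilinear (h : IsScalarExtension ι) {ρ : L → L} {f g : V → X}
    (hf : ∀ x y, f (x + y) = f x + f y) (hf' : ∀ (c : L) x, f (c • x) = ρ c • f x)
    (hg : ∀ x y, g (x + y) = g x + g y) (hg' : ∀ (c : L) x, g (c • x) = ρ c • g x)
    (hfg : ∀ x, f (ι x) = g (ι x)) (v : V) : f v = g v := by
  have hv : v ∈ Submodule.span L (Set.range ι) := h.span_range ▸ Submodule.mem_top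
  induction hv using Submodule.span_induction with
  | mem x hx =>
    obtain ⟨x, rfl⟩ := hx
    exact hfg x
  | zero =>
    have h1 : f 0 = 0 := by simpa using hf 0 0
    have h2 : g 0 = 0 := by simpa using hg 0 0
    rw [h1, h2]
  | add x y _ _ hx hy => rw [hf, hg, hx, hy]
  | smul c x _ hx => rw [hf', hg', hx]

/-- A functional separating `e` from `A` extends to `V` by the universal property and still
separates `ι e` from the span of `ι '' A`. -/
lemma notMem_span_image (h : IsScalarExtension ι) {A : Submodule K M} {e : M} (he : e ∉ A) :
    ι e ∉ Submodule.span L (ι '' A) := by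
  obtain ⟨u, hue, huA⟩ := exists_dual_eq_one he
  let f : M →ₛₗ[φ] L :=
    { toFun := fun x => φ (u x)
      map_add' := fun x y => by simp
      map_smul' := fun c x => by simp }
  obtain ⟨g, hg⟩ := h.exists_lift f
  intro hmem
  have hle : Submodule.span L (ι '' A) ≤ LinearMap.ker g := by
    rw [Submodule.span_le]
    rintro _ ⟨x, hx, rfl⟩
    simp [hg, f, huA x hx]
  have := hle hmem
  simp [hg, f, hue] at this

lemma injective (h : IsScalarExtension ι) : Function.Injective ι := by
  refine (injective_iff_map_eq_zero ι).mpr fun x hx => ?_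
  by_contra hne
  refine h.notMem_span_image (A := ⊥) (e := x) (by simpa using hne) ?_
  rw [hx]
  exact Submodule.zero_mem _

end IsScalarExtension

/-- A chain in `M` induces one in every extension of scalars of `M`. -/
lemma SlopeChain.scalarExtension [FiniteDimensional K M] {Γ : Type*} {val : K → Γ} {val' : L → Γ}
    (hval : ∀ a, a ≠ 0 → val' (φ a) = val a)
    {ι : M →ₛₗ[φ] V} (hι : IsScalarExtension ι) {Φ : M → M} {Ψ : V → V}
    (hΦ : ∀ x, Ψ (ι x) = ι (Φ x)) {A B : Submodule K M} {S : Multiset Γ}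
    (h : SlopeChain val Φ A B S) :
    SlopeChain val' Ψ (Submodule.span L (ι '' A)) (Submodule.span L (ι '' B)) S := by
  induction h with
  | refl A => exact refl _
  | @step A B S e a he ha hea _ ih =>
    rw [← hval a ha]
    refine step (ι e) (φ a) (hι.notMem_span_image he) ((map_ne_zero φ).mpr ha) ?_ ?_
    · rw [hΦ, ← map_smulₛₗ, ← map_sub]
      exact Submodule.subset_span ⟨_, hea, rfl⟩
    · convert ih using 1
      refine le_antisymm (sup_le (Submodule.span_mono (Set.image_mono ?_)) ?_) ?_
      · exact le_sup_left (a := A)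
      · rw [Submodule.span_singleton_le_iff_mem]
        exact Submodule.subset_span
          ⟨e, Submodule.mem_sup_right (Submodule.mem_span_singleton_self e), rfl⟩
      · rw [Submodule.span_le]
        rintro _ ⟨x, hx, rfl⟩
        obtain ⟨y, hy, c, hc, rfl⟩ := Submodule.mem_sup.mp hx
        obtain ⟨c, rfl⟩ := Submodule.mem_span_singleton.mp hc
        rw [map_add, map_smulₛₗ]
        exact Submodule.add_mem_sup (Submodule.subset_span ⟨y, hy, rfl⟩)
          (Submodule.smul_mem _ _ (Submodule.mem_span_singleton_self _))

lemma SlopeChain.scalarExtension_top [FiniteDimensional K M] {Γ : Type*} {val : K → Γ}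
    {val' : L → Γ} (hval : ∀ a, a ≠ 0 → val' (φ a) = val a)
    {ι : M →ₛₗ[φ] V} (hι : IsScalarExtension ι) {Φ : M → M} {Ψ : V → V}
    (hΦ : ∀ x, Ψ (ι x) = ι (Φ x)) {S : Multiset Γ} (h : SlopeChain val Φ ⊥ ⊤ S) :
    SlopeChain val' Ψ ⊥ ⊤ S := by
  have := h.scalarExtension hval hι hΦ
  rwa [Submodule.top_coe, Set.image_univ, hι.span_range, Submodule.bot_coe, Set.image_singleton,
    map_zero, Submodule.span_zero_singleton] at this

/-- Two extensions of scalars of the same difference module have the same slopes. -/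
lemma SlopeChain.congr_scalarExtension [FiniteDimensional K M] {V' : Type*} [AddCommGroup V']
    [Module L V'] {Γ : Type*} {val : L → Γ} {ι : M →ₛₗ[φ] V} (hι : IsScalarExtension ι)
    {ι' : M →ₛₗ[φ] V'} (hι' : IsScalarExtension ι') {Φ : M → M} {ρ : L → L}
    {Ψ : V → V} (hΨ : ∀ x y, Ψ (x + y) = Ψ x + Ψ y) (hΨρ : ∀ (c : L) x, Ψ (c • x) = ρ c • Ψ x)
    (hΦ : ∀ x, Ψ (ι x) = ι (Φ x))
    {Ψ' : V' → V'} (hΨ' : ∀ x y, Ψ' (x + y) = Ψ' x + Ψ' y)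
    (hΨρ' : ∀ (c : L) x, Ψ' (c • x) = ρ c • Ψ' x) (hΦ' : ∀ x, Ψ' (ι' x) = ι' (Φ x))
    {S : Multiset Γ} (h : SlopeChain val Ψ ⊥ ⊤ S) : SlopeChain val Ψ' ⊥ ⊤ S := by
  -- The universal property gives maps in both directions. They are mutually inverse and compatible
  -- with `Ψ`, `Ψ'`, because semilinear maps are determined by their values on the image of `M`.
  obtain ⟨g, hg⟩ := hι.exists_lift ι'
  obtain ⟨g', hg'⟩ := hι'.exists_lift ι
  have h1 : ∀ v, g' (g v) = v := hι.ext_of_semilinear (ρ := id) (f := g' ∘ₗ g) (g := id)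
    (by simp) (by simp) (by simp) (by simp) (by simp [hg, hg'])
  have h2 : ∀ v, g (g' v) = v := hι'.ext_of_semilinear (ρ := id) (f := g ∘ₗ g') (g := id)
    (by simp) (by simp) (by simp) (by simp) (by simp [hg, hg'])
  refine h.congr (LinearEquiv.ofLinearMap g g' (LinearMap.ext h2) (LinearMap.ext h1)) ?_
  exact hι.ext_of_semilinear (ρ := ρ) (by simp [hΨ]) (by simp [hΨρ]) (by simp [hΨ'])
    (by simp [hΨρ']) (by simp [hg, hΦ, hΦ'])

/-- Existence of the extension of scalars of a difference module. -/
lemma exists_scalarExtension {σ : K ≃+* K} {ρ : L ≃+* L} (hφ : ∀ c, ρ (φ c) = φ (σ c)) {n : ℕ}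
    (b : Module.Basis (Fin n) K M) (Φ : M →+ M) (hΦ : ∀ (c : K) x, Φ (c • x) = σ c • Φ x) :
    ∃ (ι : M →ₛₗ[φ] (Fin n → L)) (Ψ : (Fin n → L) →+ (Fin n → L)), IsScalarExtension ι ∧
      (∀ (c : L) x, Ψ (c • x) = ρ c • Ψ x) ∧ ∀ x, Ψ (ι x) = ι (Φ x) := by
  let ι : M →ₛₗ[φ] (Fin n → L) :=
    { toFun := fun x i => φ (b.repr x i)
      map_add' := fun x y => by ext i; simp
      map_smul' := fun c x => by ext i; simp }
  -- The semilinear map over `L` whose matrix is the image under `φ` of the matrix of `Φ`.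
  let Ψ : (Fin n → L) →+ (Fin n → L) :=
    { toFun := fun v => ∑ i, ρ (v i) • ι (Φ (b i))
      map_zero' := by simp
      map_add' := fun v w => by simp [add_smul, Finset.sum_add_distrib] }
  refine ⟨ι, Ψ, .of_basis (b := b) (b' := Pi.basisFun L (Fin n)) ?_, ?_, ?_⟩
  · intro i
    ext j
    simp [ι, Finsupp.single_apply, Pi.single_apply, eq_comm]
  · intro c x
    simp [Ψ, Finset.smul_sum, mul_smul]
  · intro x
    conv_rhs => rw [← b.sum_repr x]
    simp only [map_sum, hΦ, map_smulₛₗ, ← hφ]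
    rfl

lemma isScalarExtension_mk [Algebra K L] (ι : M →ₛₗ[algebraMap K L] L ⊗[K] M)
    (hι : ∀ x, ι x = 1 ⊗ₜ x) : IsScalarExtension ι := by
  intro n b
  exact ⟨b.baseChange L, fun i => by simp [hι]⟩

/-- A surjective semilinear endomorphism of a finite-dimensional space is injective. -/
lemma injective_of_surjective_of_semilinear [FiniteDimensional K M] {σ : K ≃+* K} {Φ : M →+ M}
    (hΦ : ∀ (c : K) x, Φ (c • x) = σ c • Φ x) (hs : Function.Surjective Φ) :
    Function.Injective Φ := by
  let b := Module.finBasis K M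
  have hspan : ⊤ ≤ Submodule.span K (Set.range fun i => Φ (b i)) := by
    rintro x -
    obtain ⟨y, rfl⟩ := hs x
    rw [← b.sum_repr y, map_sum]
    refine Submodule.sum_mem _ fun j _ => ?_
    rw [hΦ]
    exact Submodule.smul_mem _ _ (Submodule.subset_span ⟨j, rfl⟩)
  -- The images of a basis span by surjectivity, hence they are independent by counting.
  have hli := linearIndependent_of_top_le_span_of_card_eq_finrank hspan (by simp)
  refine (injective_iff_map_eq_zero Φ).mpr fun x hx => ?_
  rw [← b.sum_repr x, map_sum] at hx
  simp only [hΦ] at hx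
  have h0 := Fintype.linearIndependent_iff.mp hli _ hx
  rw [← b.sum_repr x]
  refine Finset.sum_eq_zero fun i _ => ?_
  rw [(map_eq_zero σ).mp (h0 i), zero_smul]

/-- The extension of scalars of a surjective semilinear map is surjective. -/
lemma IsScalarExtension.surjective [FiniteDimensional K M] {ρ : L ≃+* L}
    {ι : M →ₛₗ[φ] V} (hι : IsScalarExtension ι) {Φ : M →+ M} {Ψ : V →+ V}
    (hΦs : Function.Surjective Φ)
    (hΨ : ∀ (c : L) x, Ψ (c • x) = ρ c • Ψ x) (hΨΦ : ∀ x, Ψ (ι x) = ι (Φ x)) :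
    Function.Surjective Ψ := by
  intro v
  have hv : v ∈ Submodule.span L (Set.range ι) := hι.span_range ▸ Submodule.mem_top
  induction hv using Submodule.span_induction with
  | mem x hx =>
    obtain ⟨x, rfl⟩ := hx
    obtain ⟨y, rfl⟩ := hΦs x
    exact ⟨ι y, hΨΦ y⟩
  | zero => exact ⟨0, map_zero Ψ⟩
  | add x y _ _ hx hy =>
    obtain ⟨x', rfl⟩ := hx
    obtain ⟨y', rfl⟩ := hy
    exact ⟨x' + y', map_add Ψ _ _⟩
  | smul c x _ hx =>
    obtain ⟨x', rfl⟩ := hx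
    exact ⟨ρ.symm c • x', by rw [hΨ, ρ.apply_symm_apply]⟩

end ScalarExtension

/-! ### A scalar `q`-difference equation -/

section ScalarEquation

/-- Let `p` be a polynomial without constant term. If `p ≠ 0`, the equation `p(w) = 1` has a
solution of minimal modulus. -/
lemma exists_root_of_minimal_norm {n : ℕ} {p : ℕ → ℂ} {j₀ : ℕ} (hj₀ : j₀ ∈ Finset.Icc 1 n)
    (hp : p j₀ ≠ 0) : ∃ w : ℂ, w ≠ 0 ∧ ∑ j ∈ Finset.Icc 1 n, w ^ j * p j = 1 ∧
      ∀ u : ℂ, ‖u‖ < ‖w‖ → ∑ j ∈ Finset.Icc 1 n, u ^ j * p j ≠ 1 := by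
  classical
  let P : Polynomial ℂ := ∑ j ∈ Finset.Icc 1 n, Polynomial.C (p j) * Polynomial.X ^ j - 1
  have heval : ∀ u, P.eval u = ∑ j ∈ Finset.Icc 1 n, u ^ j * p j - 1 := fun u => by
    simp only [P, Polynomial.eval_sub, Polynomial.eval_finsetSum, Polynomial.eval_mul,
      Polynomial.eval_C, Polynomial.eval_pow, Polynomial.eval_X, Polynomial.eval_one,
      mul_comm (p _)]
  have hj1 : j₀ ≠ 0 := by
    have := (Finset.mem_Icc.mp hj₀).1
    omega
  have hcoeff : P.coeff j₀ = p j₀ := by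
    simp only [P, Polynomial.coeff_sub, Polynomial.finsetSum_coeff, Polynomial.coeff_C_mul_X_pow,
      Polynomial.coeff_one, if_neg hj1, sub_zero]
    rw [Finset.sum_ite_eq, if_pos hj₀]
  have hP : P ≠ 0 := fun h => hp (by rw [← hcoeff, h, Polynomial.coeff_zero])
  have hdeg : P.degree ≠ 0 := by
    intro h
    have := Polynomial.coeff_eq_zero_of_degree_lt (p := P) (n := j₀) (by
      rw [h]; exact_mod_cast Nat.pos_of_ne_zero hj1)
    exact hp (hcoeff ▸ this)
  obtain ⟨w₀, hw₀⟩ := IsAlgClosed.exists_root P hdeg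
  obtain ⟨w, hw, hmin⟩ := P.roots.toFinset.exists_min_image (fun w => ‖w‖)
    ⟨w₀, by simpa [hP] using hw₀⟩
  have hroot : ∀ u, u ∈ P.roots.toFinset ↔ ∑ j ∈ Finset.Icc 1 n, u ^ j * p j = 1 := fun u => by
    rw [Multiset.mem_toFinset, Polynomial.mem_roots hP, Polynomial.IsRoot, heval, sub_eq_zero]
  refine ⟨w, ?_, (hroot w).mp hw, fun u hu h => absurd (hmin u ((hroot u).mpr h)) (not_le.mpr hu)⟩
  rintro rfl
  have h0 := (hroot 0).mp hw
  rw [Finset.sum_eq_zero] at h0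
  · exact zero_ne_one h0
  · intro j hj
    have := (Finset.mem_Icc.mp hj).1
    rw [zero_pow (by omega), zero_mul]

/-- A sequence bounded by its convolution with a geometric sequence grows at most
geometrically. -/
lemma norm_le_pow_of_recursion {y : ℕ → ℂ} {A R : ℝ} (hA : 0 < A) (hR : 0 < R) (h0 : ‖y 0‖ ≤ 1)
    (h : ∀ m, 0 < m → ‖y m‖ ≤ ∑ k ∈ Finset.range m, A * R ^ (m - k) * ‖y k‖) (m : ℕ) :
    ‖y m‖ ≤ (R * (1 + A)) ^ m := by
  induction m using Nat.strong_induction_on with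
  | _ m ih =>
    rcases Nat.eq_zero_or_pos m with rfl | hm
    · simpa using h0
    -- The ratio `R * (1 + A)` is chosen so that the powers of `R` combine to `R ^ m` and `A * ∑ (1
    -- + A) ^ k` sums to `(1 + A) ^ m - 1`.
    calc ‖y m‖ ≤ ∑ k ∈ Finset.range m, A * R ^ (m - k) * ‖y k‖ := h m hm
      _ ≤ ∑ k ∈ Finset.range m, R ^ m * A * (1 + A) ^ k := by
        refine Finset.sum_le_sum fun k hk => ?_
        have hk := Finset.mem_range.mp hk
        calc A * R ^ (m - k) * ‖y k‖ ≤ A * R ^ (m - k) * (R * (1 + A)) ^ k := by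
              gcongr
              exact ih k hk
          _ = A * (R ^ (m - k) * R ^ k) * (1 + A) ^ k := by rw [mul_pow]; ring
          _ = R ^ m * A * (1 + A) ^ k := by
            rw [← pow_add, Nat.sub_add_cancel hk.le]; ring
      _ = R ^ m * ((1 + A - 1) * ∑ k ∈ Finset.range m, (1 + A) ^ k) := by
        rw [← Finset.mul_sum]; ring
      _ = R ^ m * ((1 + A) ^ m - 1) := by rw [mul_geom_sum]
      _ ≤ (R * (1 + A)) ^ m := by
        rw [mul_pow]
        gcongr
        linarith

/-- The coefficients of a power series grow at most geometrically. -/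
def HasGeometricBound (P : PowerSeries ℂ) : Prop :=
  ∃ A R : ℝ, ∀ m, ‖PowerSeries.coeff m P‖ ≤ A * R ^ m

lemma HasGeometricBound.exists_uniform {n : ℕ} {G : ℕ → PowerSeries ℂ}
    (h : ∀ j ∈ Finset.Icc 1 n, HasGeometricBound (G j)) :
    ∃ A R : ℝ, 0 < A ∧ 0 < R ∧
      ∀ j ∈ Finset.Icc 1 n, ∀ m, ‖PowerSeries.coeff m (G j)‖ ≤ A * R ^ m := by
  choose! A R h using h
  refine ⟨1 + ∑ j ∈ Finset.Icc 1 n, |A j|, 1 + ∑ j ∈ Finset.Icc 1 n, |R j|, by positivity,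
    by positivity, fun j hj m => (h j hj m).trans ?_⟩
  have hA : |A j| ≤ 1 + ∑ j ∈ Finset.Icc 1 n, |A j| := by
    have := Finset.single_le_sum (f := fun j => |A j|) (fun _ _ => abs_nonneg _) hj
    linarith
  have hR : |R j| ≤ 1 + ∑ j ∈ Finset.Icc 1 n, |R j| := by
    have := Finset.single_le_sum (f := fun j => |R j|) (fun _ _ => abs_nonneg _) hj
    linarith
  calc A j * R j ^ m ≤ |A j| * |R j| ^ m := by
        rw [← abs_pow, ← abs_mul]; exact le_abs_self _
    _ ≤ _ := by gcongr

/-- Formal solution of the scalar `q`-difference equation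
`y(z) = ∑_{1 ≤ j ≤ n} w ^ j G_j(z) y(d ^ j z)`, `|d| < 1`, with an estimate of its coefficients. -/
theorem exists_formal_solution {d : ℂ} (hd : ‖d‖ < 1) {n : ℕ} (G : ℕ → PowerSeries ℂ) {j₀ : ℕ}
    (hj₀ : j₀ ∈ Finset.Icc 1 n) (hG : PowerSeries.coeff 0 (G j₀) ≠ 0) :
    ∃ (w : ℂ) (Y : PowerSeries ℂ), w ≠ 0 ∧ Y ≠ 0 ∧
      Y = ∑ j ∈ Finset.Icc 1 n, PowerSeries.C (w ^ j) * G j * PowerSeries.rescale (d ^ j) Y ∧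
      ((∀ j ∈ Finset.Icc 1 n, HasGeometricBound (G j)) → HasGeometricBound Y) := by
  -- At order `m` the equation reads `(1 - χ m) y_m = (terms in y_k, k < m)`, where `χ m` is the
  -- characteristic polynomial at `w d ^ m`. The choice of `w` gives `χ 0 = 1`, which leaves `y_0`
  -- free. Minimality of `‖w‖` with `‖d‖ < 1` gives `χ m ≠ 1` for `m > 0`, so there is no resonance.
  obtain ⟨w, hw, hw1, hmin⟩ := exists_root_of_minimal_norm
    (p := fun j => PowerSeries.coeff 0 (G j)) hj₀ hG
  let χ : ℕ → ℂ := fun m => ∑ j ∈ Finset.Icc 1 n, (w * d ^ m) ^ j * PowerSeries.coeff 0 (G j)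
  have hχ : ∀ m, 0 < m → 1 - χ m ≠ 0 := by
    intro m hm h
    refine hmin (w * d ^ m) ?_ (sub_eq_zero.mp h).symm
    rw [norm_mul, norm_pow]
    exact mul_lt_of_lt_one_right (norm_pos_iff.mpr hw)
      (pow_lt_one₀ (norm_nonneg _) hd hm.ne')
  let rhs : ∀ m, (∀ k, k < m → ℂ) → ℂ := fun m y => ∑ j ∈ Finset.Icc 1 n, w ^ j *
    ∑ k : Fin m, PowerSeries.coeff (m - k) (G j) * (d ^ j) ^ (k : ℕ) * y k k.2
  let y : ℕ → ℂ := fun m => Nat.strongRec (motive := fun _ => ℂ)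
    (fun m y => if m = 0 then 1 else (1 - χ m)⁻¹ * rhs m y) m
  have hyr : ∀ m, y m = if m = 0 then 1 else (1 - χ m)⁻¹ * rhs m (fun k _ => y k) := by
    intro m
    simp only [y]
    rw [Nat.strongRec_eq]
  have hrhs : ∀ m, rhs m (fun k _ => y k) = ∑ j ∈ Finset.Icc 1 n, w ^ j *
      ∑ k ∈ Finset.range m, PowerSeries.coeff (m - k) (G j) * (d ^ j) ^ k * y k := by
    intro m
    refine Finset.sum_congr rfl fun j _ => ?_
    rw [← Fin.sum_univ_eq_sum_range (fun k => PowerSeries.coeff (m - k) (G j) * (d ^ j) ^ k * y k)]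
  have hy0 : y 0 = 1 := by rw [hyr]; simp
  have hym : ∀ m, 0 < m → y m = (1 - χ m)⁻¹ * ∑ j ∈ Finset.Icc 1 n, w ^ j *
      ∑ k ∈ Finset.range m, PowerSeries.coeff (m - k) (G j) * (d ^ j) ^ k * y k := by
    intro m hm
    rw [hyr, if_neg hm.ne', hrhs]
  refine ⟨w, PowerSeries.mk y, hw, ?_, ?_, ?_⟩
  · intro h
    have := congrArg (PowerSeries.coeff 0) h
    rw [PowerSeries.coeff_mk, hy0, map_zero] at this
    exact one_ne_zero this
  · ext m
    have hsplit : PowerSeries.coeff m (∑ j ∈ Finset.Icc 1 n, PowerSeries.C (w ^ j) * G j *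
        PowerSeries.rescale (d ^ j) (PowerSeries.mk y)) = χ m * y m + ∑ j ∈ Finset.Icc 1 n, w ^ j *
      ∑ k ∈ Finset.range m, PowerSeries.coeff (m - k) (G j) * (d ^ j) ^ k * y k := by
      rw [map_sum, Finset.sum_mul, ← Finset.sum_add_distrib]
      refine Finset.sum_congr rfl fun j _ => ?_
      rw [mul_assoc, PowerSeries.coeff_C_mul, mul_comm (G j), PowerSeries.coeff_mul,
        Finset.Nat.sum_antidiagonal_eq_sum_range_succ_mk, Finset.sum_range_succ]
      simp only [PowerSeries.coeff_rescale, PowerSeries.coeff_mk, Nat.sub_self]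
      rw [mul_add, add_comm, mul_pow, ← pow_mul, ← pow_mul, mul_comm m j]
      congr 1
      · ring
      · congr 1
        refine Finset.sum_congr rfl fun k _ => ?_
        ring
    rw [hsplit, PowerSeries.coeff_mk]
    rcases Nat.eq_zero_or_pos m with rfl | hm
    · have : χ 0 = 1 := by simpa [χ] using hw1
      simp [this]
    · have h1 := hym m hm
      rw [eq_inv_mul_iff_mul_eq₀ (hχ m hm)] at h1
      rw [← h1]
      ring
  · intro hb
    obtain ⟨A, R, hA, hR, hGb⟩ := HasGeometricBound.exists_uniform hb
    -- There are no small divisors: `w d ^ m → 0` and the characteristic polynomial has no constant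
    -- term, so the inverses tend to `1` and are bounded.
    have hlim : Filter.Tendsto (fun m => (1 - χ m)⁻¹) Filter.atTop (𝓝 1) := by
      have h1 : Filter.Tendsto (fun m : ℕ => w * d ^ m) Filter.atTop (𝓝 0) := by
        simpa using (tendsto_pow_atTop_nhds_zero_of_norm_lt_one hd).const_mul w
      have h2 : Filter.Tendsto χ Filter.atTop (𝓝 0) := by
        have h3 : ∑ j ∈ Finset.Icc 1 n, (0 : ℂ) ^ j * PowerSeries.coeff 0 (G j) = 0 := by
          refine Finset.sum_eq_zero fun j hj => ?_
          have := (Finset.mem_Icc.mp hj).1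
          rw [zero_pow (by omega), zero_mul]
        rw [← h3]
        exact tendsto_finsetSum _ fun j _ => (h1.pow j).mul_const _
      have h4 := (h2.const_sub 1).inv₀ (by rw [sub_zero]; exact one_ne_zero)
      rwa [sub_zero, inv_one] at h4
    obtain ⟨D, hD⟩ := hlim.norm.bddAbove_range
    have hD : ∀ m, ‖(1 - χ m)⁻¹‖ ≤ D := fun m => hD ⟨m, rfl⟩
    let W : ℝ := ∑ j ∈ Finset.Icc 1 n, ‖w‖ ^ j
    have hW : 0 ≤ W := Finset.sum_nonneg fun j _ => by positivity
    have hpos : 0 < |D| * (W * A) + 1 :=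
      add_pos_of_nonneg_of_pos (mul_nonneg (abs_nonneg D) (mul_nonneg hW hA.le)) one_pos
    refine ⟨1, R * (1 + (|D| * (W * A) + 1)), fun m => ?_⟩
    rw [PowerSeries.coeff_mk, one_mul]
    refine norm_le_pow_of_recursion hpos hR (by rw [hy0, norm_one]) (fun m hm => ?_) m
    rw [hym m hm, norm_mul]
    have hsum : ‖∑ j ∈ Finset.Icc 1 n, w ^ j *
        ∑ k ∈ Finset.range m, PowerSeries.coeff (m - k) (G j) * (d ^ j) ^ k * y k‖ ≤
        ∑ j ∈ Finset.Icc 1 n, ‖w‖ ^ j * ∑ k ∈ Finset.range m, A * R ^ (m - k) * ‖y k‖ := by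
      refine (norm_sum_le _ _).trans (Finset.sum_le_sum fun j hj => ?_)
      rw [norm_mul, norm_pow]
      gcongr
      refine (norm_sum_le _ _).trans (Finset.sum_le_sum fun k _ => ?_)
      rw [norm_mul, norm_mul]
      refine mul_le_mul_of_nonneg_right ?_ (norm_nonneg _)
      refine (mul_le_of_le_one_right (norm_nonneg _) ?_).trans (hGb j hj _)
      rw [norm_pow, norm_pow]
      exact pow_le_one₀ (by positivity) (pow_le_one₀ (norm_nonneg _) hd.le)
    calc ‖(1 - χ m)⁻¹‖ * _ ≤ |D| * (∑ j ∈ Finset.Icc 1 n, ‖w‖ ^ j *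
          ∑ k ∈ Finset.range m, A * R ^ (m - k) * ‖y k‖) :=
          mul_le_mul ((hD m).trans (le_abs_self D)) hsum (norm_nonneg _) (abs_nonneg _)
      _ = ∑ k ∈ Finset.range m, (|D| * (W * A)) * R ^ (m - k) * ‖y k‖ := by
        rw [← Finset.sum_mul, Finset.mul_sum, Finset.mul_sum]
        refine Finset.sum_congr rfl fun k _ => ?_
        ring
      _ ≤ _ := by
        refine Finset.sum_le_sum fun k _ => ?_
        gcongr
        linarith

/-! ### Convergence of solutions and their continuation to the plane -/

/-- Summability at one nonzero point bounds the coefficients geometrically. Conversely a geometric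
bound gives a positive radius of convergence. -/
lemma mem_convergent_iff {P : PowerSeries ℂ} :
    HahnSeries.ofPowerSeries ℤ ℂ P ∈ BaseField.convergent.toSubfield ↔ HasGeometricBound P := by
  constructor
  · rintro ⟨F, -, hF⟩
    rw [IsLaurentExpansion.ofPowerSeries] at hF
    obtain ⟨z, hz, hz0⟩ := (hF.and self_mem_nhdsWithin).exists
    have hz0 : z ≠ 0 := hz0
    obtain ⟨A, hA⟩ := hz.summable.tendsto_atTop_zero.norm.bddAbove_range
    refine ⟨A, ‖z‖⁻¹, fun m => ?_⟩
    have h1 : ‖PowerSeries.coeff m P * z ^ m‖ ≤ A := hA ⟨m, rfl⟩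
    rw [norm_mul, norm_pow] at h1
    rwa [inv_pow, ← div_eq_mul_inv, le_div_iff₀ (by positivity)]
  · rintro ⟨A, R, h⟩
    let p : FormalMultilinearSeries ℂ ℂ ℂ := FormalMultilinearSeries.ofScalars ℂ
      (fun n => PowerSeries.coeff n P)
    have hpc : ∀ n, p.coeff n = PowerSeries.coeff n P := fun n => by
      simp [p, FormalMultilinearSeries.coeff_ofScalars]
    have hr : 0 < p.radius := by
      refine lt_of_lt_of_le (b := (((‖R‖₊ + 1)⁻¹ : NNReal) : ENNReal))
        (ENNReal.coe_pos.mpr (by positivity)) ?_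
      refine p.le_radius_of_bound |A| fun n => ?_
      rw [FormalMultilinearSeries.norm_apply_eq_norm_coef, hpc]
      have h1 : ‖PowerSeries.coeff n P‖ ≤ |A| * (|R| + 1) ^ n := by
        refine (h n).trans ((le_abs_self _).trans ?_)
        rw [abs_mul, abs_pow]
        gcongr
        linarith
      push_cast
      rw [inv_pow, ← div_eq_mul_inv, div_le_iff₀ (by positivity)]
      simpa using h1
    have hp := (p.hasFPowerSeriesOnBall hr).hasFPowerSeriesAt
    refine ⟨p.sum, ?_, ?_⟩
    · intro z hz
      rw [Set.mem_singleton_iff.mp hz]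
      exact hp.analyticAt.meromorphicAt
    · rw [IsLaurentExpansion.ofPowerSeries]
      rw [hasFPowerSeriesAt_iff] at hp
      filter_upwards [hp.filter_mono nhdsWithin_le_nhds] with z hz
      simpa [hpc, mul_comm] using hz

lemma IsLaurentExpansion.sum {ι : Type*} (s : Finset ι) {f : ι → LaurentSeries ℂ}
    {F : ι → ℂ → ℂ} (h : ∀ i ∈ s, IsLaurentExpansion (f i) (F i)) :
    IsLaurentExpansion (∑ i ∈ s, f i) (fun z => ∑ i ∈ s, F i z) := by
  classical
  induction s using Finset.induction_on with
  | empty => simpa using IsLaurentExpansion.zero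
  | insert a s ha ih =>
    simp only [Finset.sum_insert ha]
    exact (h a (Finset.mem_insert_self _ _)).add
      (ih fun i hi => h i (Finset.mem_insert_of_mem hi))

lemma laurentSubfield_meromorphic_le {f : LaurentSeries ℂ}
    (hf : f ∈ BaseField.meromorphic.toSubfield) : f ∈ BaseField.convergent.toSubfield := by
  obtain ⟨F, hF, h⟩ := hf
  exact ⟨F, fun z _ => hF z (Set.mem_univ _), h⟩

/-- A convergent solution of a scalar `q`-difference equation whose coefficients are meromorphic
on `ℂ` is meromorphic on `ℂ`. -/
theorem mem_meromorphic_of_equation {c : ℂˣ} (hc : 1 < ‖(c : ℂ)‖) {n : ℕ}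
    {g : ℕ → LaurentSeries ℂ}
    (hg : ∀ j ∈ Finset.Icc 1 n, g j ∈ BaseField.meromorphic.toSubfield) {y : LaurentSeries ℂ}
    (hy : y ∈ BaseField.convergent.toSubfield)
    (h : y = ∑ j ∈ Finset.Icc 1 n, g j * dilate (c⁻¹ ^ j) y) :
    y ∈ BaseField.meromorphic.toSubfield := by
  obtain ⟨F, hF, hyF⟩ := hy
  replace hF : MeromorphicAt F 0 := hF 0 rfl
  choose! G hG hgG using hg
  -- `L` is the right side of the equation as an operator on functions. `L F` at `z` uses `F` only
  -- at points of modulus at most `‖z‖ / ‖c‖`, so each application enlarges the disc of meromorphy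
  -- by the factor `‖c‖`.
  let L : (ℂ → ℂ) → ℂ → ℂ := fun F z =>
    ∑ j ∈ Finset.Icc 1 n, G j z * F (((c⁻¹ ^ j : ℂˣ) : ℂ) * z)
  have hnorm : ∀ j ∈ Finset.Icc 1 n, ∀ z : ℂ,
      ‖((c⁻¹ ^ j : ℂˣ) : ℂ) * z‖ ≤ ‖(c : ℂ)‖⁻¹ * ‖z‖ := by
    intro j hj z
    have hj1 := (Finset.mem_Icc.mp hj).1
    rw [norm_mul]
    gcongr
    rw [Units.val_pow_eq_pow_val, norm_pow, Units.val_inv_eq_inv_val, norm_inv]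
    exact pow_le_of_le_one (by positivity) (inv_le_one_of_one_le₀ hc.le) (by omega)
  have hLy : IsLaurentExpansion y (L F) := by
    rw [h]
    exact IsLaurentExpansion.sum _ fun j hj => (hgG j hj).mul (hyF.dilate _)
  have hFL : ∀ᶠ z in 𝓝[≠] (0 : ℂ), L F z = F z ∧ MeromorphicAt F z := by
    filter_upwards [hyF, hLy, hF.eventually_analyticAt] with z h1 h2 h3
    exact ⟨h2.unique h1, h3.meromorphicAt⟩
  rw [eventually_nhdsWithin_iff, Metric.eventually_nhds_iff] at hFL
  obtain ⟨r, hr, hball⟩ := hFL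
  simp only [dist_zero_right] at hball
  have hc0 : 0 < ‖(c : ℂ)‖ := by linarith
  have hshrink : ∀ N, ∀ j ∈ Finset.Icc 1 n, ∀ z : ℂ, ‖z‖ < r * ‖(c : ℂ)‖ ^ (N + 1) →
      ‖((c⁻¹ ^ j : ℂˣ) : ℂ) * z‖ < r * ‖(c : ℂ)‖ ^ N := by
    intro N j hj z hz
    refine (hnorm j hj z).trans_lt ?_
    rw [inv_mul_lt_iff₀ hc0]
    calc ‖z‖ < _ := hz
      _ = _ := by ring
  -- Successive continuations agree on the smaller disc. The centre is excluded because `L F = F` is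
  -- known only on a punctured neighbourhood of `0`.
  have hstep : ∀ N, ∀ z : ℂ, z ≠ 0 → ‖z‖ < r * ‖(c : ℂ)‖ ^ N →
      L^[N + 1] F z = L^[N] F z := by
    intro N
    induction N with
    | zero => exact fun z hz hzr => (hball (by simpa using hzr) hz).1
    | succ N ih =>
      intro z hz hzr
      rw [Function.iterate_succ_apply', Function.iterate_succ_apply' L N]
      refine Finset.sum_congr rfl fun j hj => ?_
      rw [← Function.iterate_succ_apply' L N,
        ih _ (mul_ne_zero (Units.ne_zero _) hz) (hshrink N j hj z hzr)]
  have hmero : ∀ N, ∀ z : ℂ, ‖z‖ < r * ‖(c : ℂ)‖ ^ N → MeromorphicAt (L^[N] F) z := by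
    intro N
    induction N with
    | zero =>
      intro z hzr
      by_cases hz : z = 0
      · subst hz; exact hF
      · exact (hball (by simpa using hzr) hz).2
    | succ N ih =>
      intro z hzr
      rw [Function.iterate_succ_apply']
      refine MeromorphicAt.fun_sum fun j hj => ?_
      refine (hG j hj z (Set.mem_univ _)).mul ?_
      exact MeromorphicAt.comp_analyticAt (f := L^[N] F)
        (g := fun z => ((c⁻¹ ^ j : ℂˣ) : ℂ) * z) (ih _ (hshrink N j hj z hzr)) (by fun_prop)
  have hex : ∀ z : ℂ, ∃ N : ℕ, ‖z‖ < r * ‖(c : ℂ)‖ ^ N := by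
    intro z
    obtain ⟨N, hN⟩ := pow_unbounded_of_one_lt (‖z‖ / r) hc
    exact ⟨N, by rwa [div_lt_iff₀' hr] at hN⟩
  choose ν hν using hex
  -- The continuations are glued pointwise, each `z` choosing an iterate whose disc contains it. A
  -- possible mismatch at `0` is harmless, since meromorphy and Laurent expansions see only
  -- punctured neighbourhoods.
  let H : ℂ → ℂ := fun z => L^[ν z] F z
  have hmono : ∀ z : ℂ, z ≠ 0 → ∀ N, ‖z‖ < r * ‖(c : ℂ)‖ ^ N → ∀ N', N ≤ N' →
      L^[N'] F z = L^[N] F z := by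
    intro z hz N hN N' hN'
    induction N', hN' using Nat.le_induction with
    | base => rfl
    | succ N' hN' ih =>
      rw [hstep N' z hz (hN.trans_le ?_), ih]
      gcongr
      exact hc.le
  have hH : ∀ N, ∀ z : ℂ, z ≠ 0 → ‖z‖ < r * ‖(c : ℂ)‖ ^ N → L^[N] F z = H z := by
    intro N z hz hN
    rcases le_total N (ν z) with h1 | h1
    · exact (hmono z hz N hN _ h1).symm
    · exact hmono z hz _ (hν z) _ h1
  have hev : ∀ N, ∀ z : ℂ, ‖z‖ < r * ‖(c : ℂ)‖ ^ N → ∀ᶠ x in 𝓝[≠] z, L^[N] F x = H x := by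
    intro N z hz
    have h1 : ∀ᶠ x in 𝓝[≠] z, ‖x‖ < r * ‖(c : ℂ)‖ ^ N :=
      (continuous_norm.continuousAt.eventually_lt continuousAt_const hz).filter_mono
        nhdsWithin_le_nhds
    have h2 : ∀ᶠ x in 𝓝[≠] z, x ≠ 0 := by
      by_cases hz0 : z = 0
      · subst hz0; exact self_mem_nhdsWithin
      · exact (eventually_ne_nhds hz0).filter_mono nhdsWithin_le_nhds
    filter_upwards [h1, h2] with x hx hx0
    exact hH N x hx0 hx
  refine ⟨H, fun z _ => (hmero _ z (hν z)).congr (hev _ z (hν z)), hyF.congr ?_⟩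
  exact hev 0 0 (by simpa using hr)

end ScalarEquation

/-! ### Valuations -/

section Valuation

lemma order_eq_of_coeff {f : LaurentSeries ℂ} {n : ℤ} (hn : f.coeff n ≠ 0)
    (h : ∀ m < n, f.coeff m = 0) : f.order = n := by
  refine le_antisymm (HahnSeries.order_le_of_coeff_ne_zero hn) ?_
  by_contra hlt
  have hf : f ≠ 0 := fun h0 => hn (by simp [h0])
  exact HahnSeries.coeff_order_eq_zero.not.mpr hf (h _ (not_le.mp hlt))

lemma order_dilate (c : ℂˣ) (f : LaurentSeries ℂ) : (dilate c f).order = f.order := by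
  by_cases hf : f = 0
  · rw [hf, map_zero]
  refine order_eq_of_coeff ?_ fun m hm => ?_
  · rw [dilate_coeff]
    exact mul_ne_zero (zpow_ne_zero _ c.ne_zero) (HahnSeries.coeff_order_eq_zero.not.mpr hf)
  · rw [dilate_coeff, HahnSeries.coeff_eq_zero_of_lt_order hm, mul_zero]

lemma order_ramify (l : ℕ+) (f : LaurentSeries ℂ) : (ramify l f).order = l * f.order := by
  by_cases hf : f = 0
  · rw [hf, map_zero, HahnSeries.order_zero, mul_zero]
  have hl : (0 : ℤ) < l := by exact_mod_cast l.pos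
  refine order_eq_of_coeff ?_ fun m hm => ?_
  · rw [ramify_coeff_mul]
    exact HahnSeries.coeff_order_eq_zero.not.mpr hf
  · by_cases h : (l : ℤ) ∣ m
    · obtain ⟨m, rfl⟩ := h
      rw [ramify_coeff_mul]
      exact HahnSeries.coeff_eq_zero_of_lt_order (lt_of_mul_lt_mul_left hm hl.le)
    · exact ramify_coeff_of_not_dvd l f m h

namespace BaseField

variable {k : BaseField}

lemma v₀_mul {a b : k.K} (ha : a ≠ 0) (hb : b ≠ 0) : v₀ (a * b) = v₀ a + v₀ b :=
  HahnSeries.order_mul (by simpa using ha) (by simpa using hb)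

@[simp] lemma v₀_one : v₀ (1 : k.K) = 0 := HahnSeries.order_one

lemma v₀_inv {a : k.K} (ha : a ≠ 0) : v₀ a⁻¹ = -v₀ a := by
  have := v₀_mul ha (inv_ne_zero ha)
  rw [mul_inv_cancel₀ ha, v₀_one] at this
  omega

lemma v₀_div {a b : k.K} (ha : a ≠ 0) (hb : b ≠ 0) : v₀ (a / b) = v₀ a - v₀ b := by
  rw [div_eq_mul_inv, v₀_mul ha (inv_ne_zero hb), v₀_inv hb, sub_eq_add_neg]

@[simp] lemma v₀_sigma (c : ℂˣ) (a : k.K) : v₀ (sigma k c a) = v₀ a := order_dilate c a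

@[simp] lemma v₀_sigma_symm (c : ℂˣ) (a : k.K) : v₀ ((sigma k c).symm a) = v₀ a :=
  order_dilate c⁻¹ a

@[simp] lemma v₀_sigma_symm_iterate (c : ℂˣ) (a : k.K) (j : ℕ) :
    v₀ ((sigma k c).symm^[j] a) = v₀ a := by
  induction j with
  | zero => rfl
  | succ j ih => rw [Function.iterate_succ_apply', v₀_sigma_symm, ih]

variable (k) in
/-- The monomial `w z ^ m`, as an element of `K`. -/
def monomial (m : ℤ) (w : ℂ) : k.K :=
  ⟨HahnSeries.single m w, by
    have hm : ∀ z, MeromorphicAt (fun z : ℂ => w * z ^ m) z := fun z => by fun_prop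
    cases k with
    | meromorphic => exact ⟨_, fun z _ => hm z, IsLaurentExpansion.single m w⟩
    | convergent => exact ⟨_, fun z _ => hm z, IsLaurentExpansion.single m w⟩
    | formal => trivial⟩

lemma coe_monomial (m : ℤ) (w : ℂ) :
    (monomial k m w : LaurentSeries ℂ) = HahnSeries.single m w := rfl

lemma monomial_ne_zero {m : ℤ} {w : ℂ} (hw : w ≠ 0) : monomial k m w ≠ 0 := by
  intro h
  have := congrArg (fun a : k.K => (a : LaurentSeries ℂ)) h
  simp only [coe_monomial, ZeroMemClass.coe_zero] at this
  exact hw (by simpa using this)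

lemma v₀_monomial {m : ℤ} {w : ℂ} (hw : w ≠ 0) : v₀ (monomial k m w) = m :=
  HahnSeries.order_single hw

lemma monomial_zero_mul (w w' : ℂ) : monomial k 0 (w * w') = monomial k 0 w * monomial k 0 w' := by
  apply Subtype.ext
  simp [coe_monomial]

lemma sigma_symm_monomial_zero (c : ℂˣ) (w : ℂ) :
    (sigma k c).symm (monomial k 0 w) = monomial k 0 w := by
  apply Subtype.ext
  change dilate c⁻¹ (HahnSeries.single 0 w) = HahnSeries.single 0 w
  ext n
  rw [dilate_coeff]
  by_cases h : n = 0
  · subst h; simp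
  · simp [HahnSeries.coeff_single_of_ne h]

lemma coe_sigma_symm_iterate (c : ℂˣ) (a : k.K) (j : ℕ) :
    ((sigma k c).symm^[j] a : k.K) = dilate (c⁻¹ ^ j) (a : LaurentSeries ℂ) := by
  induction j with
  | zero => ext n; simp
  | succ j ih =>
    rw [Function.iterate_succ_apply']
    change dilate c⁻¹ _ = _
    rw [ih]
    ext n
    simp only [dilate_coeff, ← mul_assoc, pow_succ, Units.val_mul, mul_zpow]
    ring

end BaseField

lemma exists_ofPowerSeries {f : LaurentSeries ℂ} (hf : f ≠ 0 → 0 ≤ f.order) :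
    ∃ P : PowerSeries ℂ, f = HahnSeries.ofPowerSeries ℤ ℂ P := by
  refine ⟨PowerSeries.mk fun n => f.coeff n, ?_⟩
  ext m
  rw [PowerSeries.coeff_coe]
  split_ifs with hm
  · by_cases h0 : f = 0
    · simp [h0]
    · exact HahnSeries.coeff_eq_zero_of_lt_order (hm.trans_le (hf h0))
  · rw [PowerSeries.coeff_mk, Int.natAbs_of_nonneg (not_lt.mp hm)]

lemma dilate_ofPowerSeries (c : ℂˣ) (P : PowerSeries ℂ) :
    dilate c (HahnSeries.ofPowerSeries ℤ ℂ P) =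
      HahnSeries.ofPowerSeries ℤ ℂ (PowerSeries.rescale (c : ℂ) P) := by
  ext m
  rw [dilate_coeff, PowerSeries.coeff_coe, PowerSeries.coeff_coe]
  split_ifs with hm
  · rw [mul_zero]
  · obtain ⟨m, rfl⟩ := Int.eq_ofNat_of_zero_le (not_lt.mp hm)
    simp [PowerSeries.coeff_rescale]

open BaseField in
/-- Solution in `K` of the scalar equation `y = ∑_{j < n} w ^ (j + 1) g_j σ ^ (-j-1) (y)`. -/
theorem exists_scalar_solution (k : BaseField) {c : ℂˣ} (hc : 1 < ‖(c : ℂ)‖) {n : ℕ} (g : ℕ → k.K)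
    (hg : ∀ j < n, g j ≠ 0 → 0 ≤ v₀ (g j)) {j₀ : ℕ} (hj₀ : j₀ < n) (hg₀ : g j₀ ≠ 0)
    (hv : v₀ (g j₀) = 0) :
    ∃ (w : ℂ) (y : k.K), w ≠ 0 ∧ y ≠ 0 ∧ y = ∑ j ∈ Finset.range n,
      monomial k 0 (w ^ (j + 1)) * g j * (sigma k c).symm^[j + 1] y := by
  have hd : ‖((c⁻¹ : ℂˣ) : ℂ)‖ < 1 := by
    rw [Units.val_inv_eq_inv_val, norm_inv]
    exact inv_lt_one_of_one_lt₀ hc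
  have hP : ∀ j, ∃ P : PowerSeries ℂ, j < n →
      (g j : LaurentSeries ℂ) = HahnSeries.ofPowerSeries ℤ ℂ P := by
    intro j
    by_cases hj : j < n
    · obtain ⟨P, hP⟩ := exists_ofPowerSeries (f := (g j : LaurentSeries ℂ))
        fun h => hg j hj (by simpa using h)
      exact ⟨P, fun _ => hP⟩
    · exact ⟨0, fun h => absurd h hj⟩
  choose P hP using hP
  have hP₀ : PowerSeries.coeff 0 (P j₀) ≠ 0 := by
    have h1 : (g j₀ : LaurentSeries ℂ).coeff 0 ≠ 0 := by
      rw [← hv]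
      exact HahnSeries.coeff_order_eq_zero.not.mpr (by simpa using hg₀)
    rw [hP j₀ hj₀, PowerSeries.coeff_coe] at h1
    simpa using h1
  -- The formal equation is indexed from `1`, the coefficients `g` from `0`; hence `P (j - 1)` and
  -- `j₀ + 1`.
  obtain ⟨w, Y, hw, hY, heq, hbound⟩ := exists_formal_solution hd (n := n) (fun j => P (j - 1))
    (j₀ := j₀ + 1) (Finset.mem_Icc.mpr ⟨by omega, by omega⟩) (by simpa using hP₀)
  set y : LaurentSeries ℂ := HahnSeries.ofPowerSeries ℤ ℂ Y with hy
  let g' : ℕ → k.K := fun j => monomial k 0 (w ^ j) * g (j - 1)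
  have hpred : ∀ j ∈ Finset.Icc 1 n, j - 1 < n := fun j hj => by
    have := Finset.mem_Icc.mp hj
    omega
  have hg' : ∀ j ∈ Finset.Icc 1 n, (g' j : LaurentSeries ℂ) =
      HahnSeries.ofPowerSeries ℤ ℂ (PowerSeries.C (w ^ j) * P (j - 1)) := by
    intro j hj
    rw [map_mul, HahnSeries.ofPowerSeries_C, ← hP (j - 1) (hpred j hj)]
    rfl
  have hyeq : y = ∑ j ∈ Finset.Icc 1 n, (g' j : LaurentSeries ℂ) * dilate (c⁻¹ ^ j) y := by
    conv_lhs => rw [hy, heq, map_sum]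
    refine Finset.sum_congr rfl fun j hj => ?_
    rw [map_mul, hg' j hj, hy, dilate_ofPowerSeries, Units.val_pow_eq_pow_val]
  have hmem : y ∈ k.toSubfield := by
    have hconv : (∀ j < n, (g j : LaurentSeries ℂ) ∈ BaseField.convergent.toSubfield) →
        y ∈ BaseField.convergent.toSubfield := by
      intro h
      refine mem_convergent_iff.mpr (hbound fun j hj => ?_)
      rw [← mem_convergent_iff, ← hP (j - 1) (hpred j hj)]
      exact h _ (hpred j hj)
    cases k with
    | meromorphic =>
      exact mem_meromorphic_of_equation hc (fun j _ => (g' j).2)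
        (hconv fun j _ => laurentSubfield_meromorphic_le (g j).2) hyeq
    | convergent => exact hconv fun j _ => (g j).2
    | formal => trivial
  refine ⟨w, ⟨y, hmem⟩, hw, ?_, ?_⟩
  · intro h
    have : y = 0 := congrArg (fun a : k.K => (a : LaurentSeries ℂ)) h
    rw [hy] at this
    exact hY (HahnSeries.ofPowerSeries_injective (by rw [this, map_zero]))
  · have hIcc : Finset.Icc 1 n = Finset.Ico (0 + 1) (n + 1) := by
      ext
      simp
    have : (⟨y, hmem⟩ : k.K) = ∑ j ∈ Finset.Icc 1 n, g' j * (sigma k c).symm^[j] ⟨y, hmem⟩ := by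
      apply Subtype.ext
      rw [AddSubmonoidClass.coe_finsetSum]
      refine hyeq.trans ?_
      refine Finset.sum_congr rfl fun j _ => ?_
      change _ = (g' j : LaurentSeries ℂ) *
        (((sigma k c).symm^[j] ⟨y, hmem⟩ : k.K) : LaurentSeries ℂ)
      rw [coe_sigma_symm_iterate]
    rw [hIcc, ← Finset.sum_Ico_add', ← Finset.range_eq_Ico] at this
    exact this

end Valuation

/-! ### Eigenvectors -/

section Eigenvector

open BaseField

variable {k : BaseField} {V : Type*} [AddCommGroup V] [Module k.K V]

/-- A cyclic integral module with non-nilpotent reduction has an eigenvector. -/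
theorem exists_eigenvector_of_cyclic {c : ℂˣ} (hc : 1 < ‖(c : ℂ)‖) (U : V →+ V)
    (hU : ∀ (a : k.K) x, U (a • x) = (sigma k c).symm a • U x) {e : V} {n : ℕ} {β : ℕ → k.K}
    (hrel : U^[n + 1] e = ∑ i ∈ Finset.range (n + 1), β i • U^[i] e)
    (hmin : U^[n] e ∉ Submodule.span k.K ((fun i => U^[i] e) '' Finset.range n))
    (hβ : ∀ i < n + 1, β i ≠ 0 → 0 ≤ v₀ (β i)) {i₀ : ℕ} (hi₀ : i₀ < n + 1) (hβ₀ : β i₀ ≠ 0)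
    (hv : v₀ (β i₀) = 0) :
    ∃ (x : V) (w : ℂ), x ≠ 0 ∧ w ≠ 0 ∧ x = monomial k 0 w • U x := by
  set s := (sigma k c).symm with hs
  -- Write `x = ∑ X i • U^i e`, `i ≤ n`. Comparing coefficients in `x = w U x` gives a recursion for
  -- `X i` in terms of `y = X n`; unrolling it to `i = n` leaves a scalar equation for `y`, with
  -- coefficients `s^j (β (n - j))`.
  obtain ⟨w, y, hw, hy, heq⟩ := exists_scalar_solution k hc (n := n + 1)
    (fun j => s^[j] (β (n - j))) (j₀ := n - i₀)
    (fun j hj h => by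
      rw [v₀_sigma_symm_iterate]
      refine hβ _ (by omega) fun h0 => h ?_
      rw [h0, iterate_map_zero])
    (by omega)
    (by
      rw [show n - (n - i₀) = i₀ by omega]
      intro h
      have h1 : s^[n - i₀] (β i₀) = s^[n - i₀] 0 := by rw [h, iterate_map_zero]
      exact hβ₀ (s.injective.iterate _ h1))
    (by rw [v₀_sigma_symm_iterate, show n - (n - i₀) = i₀ by omega, hv])
  let ω := monomial k 0 w
  let X : ℕ → k.K := Nat.rec (ω * (β 0 * s y)) fun i Xi => ω * (s Xi + β (i + 1) * s y)
  have hX0 : X 0 = ω * (β 0 * s y) := rfl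
  have hXs : ∀ i, X (i + 1) = ω * (s (X i) + β (i + 1) * s y) := fun i => rfl
  have hsω : ∀ v, s (monomial k 0 v) = monomial k 0 v := sigma_symm_monomial_zero c
  have hsi : ∀ j a, s^[j + 1] a = s (s^[j] a) := fun j a => Function.iterate_succ_apply' _ _ _
  have hX : ∀ i, X i = ∑ j ∈ Finset.range (i + 1),
      monomial k 0 (w ^ (j + 1)) * s^[j] (β (i - j)) * s^[j + 1] y := by
    intro i
    induction i with
    | zero => simp [hX0, ω, mul_assoc]
    | succ i ih =>
      rw [hXs, ih, map_sum, mul_add, Finset.mul_sum, Finset.sum_range_succ' _ (i + 1)]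
      congr 1
      · refine Finset.sum_congr rfl fun j _ => ?_
        rw [map_mul, map_mul, hsω, pow_succ' w (j + 1), monomial_zero_mul]
        simp only [hsi, show i + 1 - (j + 1) = i - j by omega]
        ring
      · simp [ω, mul_assoc]
  have hXn : X n = y := by rw [hX, heq.symm]
  let x := ∑ i ∈ Finset.range (n + 1), X i • U^[i] e
  refine ⟨x, w, ?_, hw, ?_⟩
  -- If `x = 0`, the nonzero leading coefficient `y` would express `U^n e` through lower iterates,
  -- against `hmin`.
  · intro hx
    apply hmin
    simp only [x, Finset.sum_range_succ, hXn] at hx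
    rw [← Submodule.smul_mem_iff _ hy, ← neg_eq_of_add_eq_zero_right hx]
    refine Submodule.neg_mem _ (Submodule.sum_mem _ fun i hi => Submodule.smul_mem _ _ ?_)
    exact Submodule.subset_span ⟨i, hi, rfl⟩
  · have h1 : U x = ∑ i ∈ Finset.range n, s (X i) • U^[i + 1] e +
        s y • ∑ i ∈ Finset.range (n + 1), β i • U^[i] e := by
      rw [← hrel, ← hXn, map_sum, Finset.sum_range_succ]
      simp only [hU, Function.iterate_succ_apply']
    rw [h1]
    simp only [x]
    rw [Finset.sum_range_succ', Finset.sum_range_succ' (fun i => β i • U^[i] e), smul_add,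
      smul_add, smul_add, ← add_assoc, Finset.smul_sum, Finset.smul_sum, Finset.smul_sum,
      ← Finset.sum_add_distrib]
    congr 1
    · refine Finset.sum_congr rfl fun i _ => ?_
      rw [hXs, smul_smul, smul_smul, smul_smul, ← add_smul]
      congr 1
      simp only [ω]
      ring
    · rw [hX0, smul_smul, smul_smul]
      congr 1
      simp only [ω]
      ring

end Eigenvector

/-! ### Ramification -/

section Ramification

open BaseField

/-- The embedding `f(z) ↦ f(z ^ l)` of `K` into itself. -/
def ramifyHom (k : BaseField) (l : ℕ+) : k.K →+* k.K := toRamified k l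

lemma coe_ramifyHom {k : BaseField} (l : ℕ+) (a : k.K) :
    (ramifyHom k l a : LaurentSeries ℂ) = ramify l a := rfl

lemma v₀_ramifyHom {k : BaseField} (l : ℕ+) (a : k.K) : v₀ (ramifyHom k l a) = l * v₀ a :=
  order_ramify l a

lemma ramifyHom_ramifyHom {k : BaseField} (l l' : ℕ+) (a : k.K) :
    ramifyHom k l' (ramifyHom k l a) = ramifyHom k (l * l') a := by
  apply Subtype.ext
  rw [coe_ramifyHom, coe_ramifyHom, coe_ramifyHom]
  ext n
  by_cases h' : (l' : ℤ) ∣ n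
  · obtain ⟨m, rfl⟩ := h'
    rw [ramify_coeff_mul]
    by_cases h : (l : ℤ) ∣ m
    · obtain ⟨m, rfl⟩ := h
      rw [ramify_coeff_mul, ← mul_assoc, mul_comm (l' : ℤ)]
      have := ramify_coeff_mul (l * l') a m
      push_cast at this
      rw [this]
    · rw [ramify_coeff_of_not_dvd _ _ _ h, ramify_coeff_of_not_dvd]
      rintro ⟨p, hp⟩
      refine h ⟨p, ?_⟩
      have hl' : (l' : ℤ) ≠ 0 := by exact_mod_cast l'.ne_zero
      apply mul_left_cancel₀ hl'
      rw [hp]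
      push_cast
      ring
  · rw [ramify_coeff_of_not_dvd _ _ _ h', ramify_coeff_of_not_dvd]
    rintro ⟨p, rfl⟩
    refine h' ⟨l * p, ?_⟩
    push_cast
    ring

lemma sigma_ramifyHom (k : BaseField) (τ : ℂ) (l : ℕ+) (a : k.K) :
    sigma k (qRoot τ l) (ramifyHom k l a) = ramifyHom k l (sigma k (qOf τ) a) :=
  sigmaRamified_algebraMap k τ l a

/-- Replacing `τ` by `τ / l` turns `(K_l, σ_{q_l})` into a base field of the original kind. Two
successive ramifications then become one of level `l * l'`. -/
lemma qRoot_div (τ : ℂ) (l l' : ℕ+) : qRoot (τ / (l : ℕ)) l' = qRoot τ (l * l') := by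
  ext
  simp only [qRoot, Units.val_mk0]
  congr 1
  have hl : ((l : ℕ) : ℂ) ≠ 0 := by exact_mod_cast l.ne_zero
  have hl' : ((l' : ℕ) : ℂ) ≠ 0 := by exact_mod_cast l'.ne_zero
  push_cast
  field_simp

lemma one_lt_norm_qRoot {τ : ℂ} (h : 1 < ‖(qOf τ : ℂ)‖) (l : ℕ+) : 1 < ‖(qRoot τ l : ℂ)‖ := by
  rw [← qRoot_pow τ l, Units.val_pow_eq_pow_val, norm_pow] at h
  by_contra hle
  exact absurd h (not_lt.mpr (pow_le_one₀ (norm_nonneg _) (not_lt.mp hle)))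

end Ramification

/-! ### Existence of triangularisations -/

section Existence

open BaseField

universe u v

/-- In the orbit of a vector under an endomorphism there is a first linear dependence. -/
lemma exists_first_dependence {K M : Type*} [Field K] [AddCommGroup M] [Module K M]
    [FiniteDimensional K M] (T : M → M) {e : M} (he : e ≠ 0) :
    ∃ n : ℕ, T^[n] e ∉ Submodule.span K ((fun i => T^[i] e) '' Finset.range n) ∧
      T^[n + 1] e ∈ Submodule.span K ((fun i => T^[i] e) '' Finset.range (n + 1)) := by
  classical
  let S : ℕ → Submodule K M := fun n => Submodule.span K ((fun i => T^[i] e) '' Finset.range n)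
  have hS : Monotone S := fun m n h => Submodule.span_mono (Set.image_mono (by
    simpa using Finset.range_mono h))
  have hex : ∃ n, T^[n] e ∈ S n := by
    obtain ⟨n, hn⟩ := monotone_stabilizes_iff_noetherian.mpr
      (inferInstance : IsNoetherian K M) ⟨S, hS⟩
    have hn : S n = S (n + 1) := hn (n + 1) n.le_succ
    refine ⟨n, hn ▸ Submodule.subset_span ⟨n, by simp, rfl⟩⟩
  -- The first dependence cannot occur at index `0`, where the span is zero and `e` is not.
  obtain ⟨n, hn⟩ : ∃ n, Nat.find hex = n + 1 := by
    refine Nat.exists_eq_succ_of_ne_zero fun h0 => he ?_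
    have := Nat.find_spec hex
    rw [h0] at this
    simpa [S] using this
  have hspec := Nat.find_spec hex
  rw [hn] at hspec
  exact ⟨n, Nat.find_min hex (by omega), hspec⟩

/-- Iterates of `z • T` for a semilinear map `T`. -/
lemma exists_iterate_smul {k : BaseField} {c : ℂˣ} {V : Type*} [AddCommGroup V] [Module k.K V]
    (T : V →+ V) (hT : ∀ (a : k.K) x, T (a • x) = (sigma k c).symm a • T x) {z : k.K}
    (hz : z ≠ 0) : ∃ d : ℕ → k.K, (∀ i, d i ≠ 0) ∧ (∀ i, v₀ (d i) = i * v₀ z) ∧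
      ∀ i x, (fun x => z • T x)^[i] x = d i • T^[i] x := by
  -- The twisted powers `z · s(z) · s²(z) ⋯` with `s = σ⁻¹`; each factor has the valuation of `z`.
  let d : ℕ → k.K := Nat.rec 1 fun _ di => z * (sigma k c).symm di
  have hds : ∀ i, d (i + 1) = z * (sigma k c).symm (d i) := fun i => rfl
  have hd0 : ∀ i, d i ≠ 0 := by
    intro i
    induction i with
    | zero => exact one_ne_zero
    | succ i ih =>
      rw [hds]
      exact mul_ne_zero hz (by simpa using ih)
  refine ⟨d, hd0, fun i => ?_, fun i x => ?_⟩
  · induction i with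
    | zero => simp [d]
    | succ i ih =>
      rw [hds, v₀_mul hz (by simpa using hd0 i), v₀_sigma_symm, ih]
      push_cast
      ring
  · induction i with
    | zero => simp [d]
    | succ i ih =>
      rw [Function.iterate_succ_apply', ih, hT, hds, mul_smul, ← Function.iterate_succ_apply' T]

/-- After ramification, every nonzero `q`-difference module has an eigenvector. -/
theorem exists_eigenvector {k : BaseField} {τ : ℂ} (hq : 1 < ‖(qOf τ : ℂ)‖) {M : Type u}
    [AddCommGroup M] [Module k.K M] [FiniteDimensional k.K M] [Nontrivial M] (Φ : M →+ M)
    (hΦ : ∀ (a : k.K) x, Φ (a • x) = sigma k (qOf τ) a • Φ x) (hs : Function.Surjective Φ) :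
    ∃ l : ℕ+, ∀ (V : Type v) [AddCommGroup V] [Module k.K V] (ι : M →ₛₗ[ramifyHom k l] V)
      (Ψ : V →+ V), IsScalarExtension ι →
      (∀ (a : k.K) x, Ψ (a • x) = sigma k (qRoot τ l) a • Ψ x) → (∀ x, Ψ (ι x) = ι (Φ x)) →
      ∃ (x : V) (a : k.K), x ≠ 0 ∧ a ≠ 0 ∧ Ψ x = a • x := by
  classical
  let Φe : M ≃+ M := AddEquiv.ofBijective Φ
    ⟨injective_of_surjective_of_semilinear hΦ hs, hs⟩
  -- The inverse of `Φ` is used because it is semilinear over `f(z) ↦ f(z / q)`, the contracting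
  -- direction in which the scalar equation is solved.
  let T : M → M := Φe.symm
  have hΦT : ∀ x, Φ (T x) = x := Φe.apply_symm_apply
  have hT0 : ∀ n x, T^[n] x = 0 → x = 0 := by
    intro n x hx
    have h0 : T^[n] 0 = 0 := iterate_map_zero Φe.symm n
    exact Φe.symm.injective.iterate n (hx.trans h0.symm)
  obtain ⟨e, he⟩ := exists_ne (0 : M)
  obtain ⟨n, hmin, hdep⟩ := exists_first_dependence (K := k.K) T he
  rw [Submodule.mem_span_image_finset_iff_exists_fun'] at hdep
  obtain ⟨b, hb⟩ := hdep
  -- This picks an extremal slope of the Newton polygon of the relation. Some coefficient is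
  -- nonzero, since otherwise `T^[n + 1] e = 0` and `e = 0`.
  obtain ⟨i₀, hi₀, hi₀min⟩ := ((Finset.range (n + 1)).filter (b · ≠ 0)).exists_min_image
    (fun i => (v₀ (b i) : ℚ) / ((n + 1 - i : ℕ) : ℚ)) (by
      by_contra hempty
      rw [Finset.not_nonempty_iff_eq_empty, Finset.filter_eq_empty_iff] at hempty
      refine he (hT0 (n + 1) e (hb ▸ Finset.sum_eq_zero fun i hi => ?_))
      rw [not_not.mp (hempty hi), zero_smul])
  rw [Finset.mem_filter, Finset.mem_range] at hi₀
  obtain ⟨hi₀n, hbi₀⟩ := hi₀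
  let l : ℕ+ := ⟨n + 1 - i₀, by omega⟩
  have hl : (l : ℕ) = n + 1 - i₀ := rfl
  refine ⟨l, fun V _ _ ι Ψ hι hΨ hΨΦ => ?_⟩
  have := hι.finiteDimensional
  have hΨs := hι.surjective hs hΨ hΨΦ
  let Ψe : V ≃+ V := AddEquiv.ofBijective Ψ
    ⟨injective_of_surjective_of_semilinear hΨ hΨs, hΨs⟩
  let T' : V →+ V := (Ψe.symm : V →+ V)
  have hΨT : ∀ x, Ψ (T' x) = x := Ψe.apply_symm_apply
  have hTΨ : ∀ x, T' (Ψ x) = x := Ψe.symm_apply_apply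
  have hT' : ∀ (a : k.K) x, T' (a • x) = (sigma k (qRoot τ l)).symm a • T' x := by
    intro a x
    apply Ψe.injective
    change Ψ (T' _) = Ψ _
    rw [hΨT, hΨ, hΨT, RingEquiv.apply_symm_apply]
  have hTι : ∀ x, T' (ι x) = ι (T x) := by
    intro x
    conv_lhs => rw [← hΦT x, ← hΨΦ, hTΨ]
  have hTιi : ∀ i x, T'^[i] (ι x) = ι (T^[i] x) := by
    intro i x
    induction i with
    | zero => rfl
    | succ i ih => rw [Function.iterate_succ_apply', ih, hTι, Function.iterate_succ_apply']
  -- The slope has denominator `n + 1 - i₀ = l`, so it becomes integral over `K_l`. With this twist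
  -- the new coefficients have valuation `(n + 1 - i₀) v₀(b i) - (n + 1 - i) v₀(b i₀)`, which is
  -- nonnegative by the choice of `i₀` and zero at `i₀`.
  let z : k.K := monomial k (-v₀ (b i₀)) 1
  have hz : z ≠ 0 := monomial_ne_zero one_ne_zero
  have hvz : v₀ z = -v₀ (b i₀) := v₀_monomial one_ne_zero
  obtain ⟨d, hd0, hdv, hd⟩ := exists_iterate_smul T' hT' hz
  let U : V →+ V := (DistribSMul.toAddMonoidHom V z).comp T'
  have hUz : ∀ x, U x = z • T' x := fun x => rfl
  have hUd : ∀ i x, U^[i] x = d i • T'^[i] x := hd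
  have hvβ : ∀ i < n + 1, b i ≠ 0 → v₀ (d (n + 1) * ramifyHom k l (b i) / d i) =
      v₀ (b i) * (n + 1 - i₀ : ℕ) - v₀ (b i₀) * (n + 1 - i : ℕ) := by
    intro i hi hbi
    have hr : ramifyHom k l (b i) ≠ 0 := (map_ne_zero _).mpr hbi
    rw [v₀_div (mul_ne_zero (hd0 _) hr) (hd0 i), v₀_mul (hd0 _) hr, hdv, hdv, hvz, v₀_ramifyHom]
    have h1 : ((l : ℕ+) : ℤ) = ((n + 1 - i₀ : ℕ) : ℤ) := rfl
    rw [h1, Nat.cast_sub hi.le]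
    push_cast
    ring
  obtain ⟨x, w, hx, hw, hxU⟩ := exists_eigenvector_of_cyclic (one_lt_norm_qRoot hq l) U
    (fun a x => by rw [hUz, hUz, hT', smul_comm])
    (e := ι e) (n := n) (β := fun i => d (n + 1) * ramifyHom k l (b i) / d i)
    (by
      rw [hUd, hTιi, ← hb, map_sum, Finset.smul_sum]
      refine Finset.sum_congr rfl fun i _ => ?_
      rw [hUd, hTιi, map_smulₛₗ, smul_smul, smul_smul, div_mul_cancel₀ _ (hd0 i)])
    (by
      intro hmem
      rw [hUd, hTιi, Submodule.smul_mem_iff _ (hd0 n)] at hmem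
      refine hι.notMem_span_image hmin (Submodule.span_le.mpr ?_ hmem)
      rintro _ ⟨i, hi, rfl⟩
      simp only [hUd, hTιi]
      exact Submodule.smul_mem _ _ (Submodule.subset_span
        ⟨_, Submodule.subset_span ⟨i, hi, rfl⟩, rfl⟩))
    (fun i hi hβi => by
      have hbi : b i ≠ 0 := fun h => hβi (by rw [h, map_zero, mul_zero, zero_div])
      rw [hvβ i hi hbi, sub_nonneg]
      have h1 := hi₀min i (Finset.mem_filter.mpr ⟨Finset.mem_range.mpr hi, hbi⟩)
      rw [div_le_div_iff₀ (by exact_mod_cast (by omega : 0 < n + 1 - i₀))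
        (by exact_mod_cast (by omega : 0 < n + 1 - i))] at h1
      exact_mod_cast h1)
    hi₀n
    (div_ne_zero (mul_ne_zero (hd0 _) ((map_ne_zero _).mpr hbi₀)) (hd0 _))
    (by rw [hvβ i₀ hi₀n hbi₀, sub_self])
  refine ⟨x, sigma k (qRoot τ l) (monomial k 0 w * z), hx, ?_, ?_⟩
  · exact (map_ne_zero _).mpr (mul_ne_zero (monomial_ne_zero hw) hz)
  -- With `ω` the constant found, `x = ω z Ψ⁻¹ x`; applying `Ψ` gives `Ψ x = σ(ω z) x`.
  · conv_lhs => rw [hxU, hUz, smul_smul, hΨ, hΨT]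

/-- The slope `v₀(a) / l` of `a ∈ K_l`. -/
def slopeVal (k : BaseField) (l : ℕ+) (a : k.K) : ℚ := (v₀ a : ℚ) / (l : ℕ)

/-- Slopes computed with `K_l` as base field are measured against `z_l`; dividing by `l` measures
them against `z`. -/
lemma slopeVal_mul_right (k : BaseField) (l l' : ℕ+) (a : k.K) :
    slopeVal k (l * l') a = slopeVal k l' a / (l : ℕ) := by
  rw [slopeVal, slopeVal, div_div, PNat.mul_coe, Nat.cast_mul, mul_comm]

lemma slopeVal_ramifyHom (k : BaseField) (l l' : ℕ+) (a : k.K) :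
    slopeVal k (l * l') (ramifyHom k l' a) = slopeVal k l a := by
  have hl : ((l : ℕ) : ℚ) ≠ 0 := by exact_mod_cast l.ne_zero
  have hl' : ((l' : ℕ) : ℚ) ≠ 0 := by exact_mod_cast l'.ne_zero
  rw [slopeVal, slopeVal, v₀_ramifyHom, PNat.mul_coe, Nat.cast_mul]
  push_cast
  field_simp

/-- The induction step for `exists_slopeChain`: a triangularisation of the quotient by an
eigenvector induces one of the module. -/
lemma exists_slopeChain_of_quotient {k : BaseField} {c c' : ℂˣ} {l' : ℕ+} {n : ℕ}
    (hc : ∀ a, sigma k c' (ramifyHom k l' a) = ramifyHom k l' (sigma k c a))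
    (Ψ : (Fin (n + 1) → k.K) →+ (Fin (n + 1) → k.K))
    (hΨ : ∀ (a : k.K) x, Ψ (a • x) = sigma k c a • Ψ x)
    {x : Fin (n + 1) → k.K} {a : k.K} (hx : x ≠ 0) (ha : a ≠ 0) (hxa : Ψ x = a • x)
    {Q : Type u} [AddCommGroup Q] [Module k.K Q] [FiniteDimensional k.K Q] {Φ : Q →+ Q}
    (π : (Fin (n + 1) → k.K) →ₗ[k.K] Q) (hπ : π x = 0) (hπs : Function.Surjective π)
    (hπΨ : ∀ y, π (Ψ y) = Φ (π y)) (hQ : Module.finrank k.K Q = n)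
    {W : Type v} [AddCommGroup W] [Module k.K W]
    {ιQ : Q →ₛₗ[ramifyHom k l'] W} {ΨQ : W →+ W} (hιQ : IsScalarExtension ιQ)
    (hΨQ : ∀ (a : k.K) y, ΨQ (a • y) = sigma k c' a • ΨQ y)
    (hΨQι : ∀ y, ΨQ (ιQ y) = ιQ (Φ y)) {val : k.K → ℚ} {S : Multiset ℚ}
    (hS : SlopeChain val ΨQ ⊥ ⊤ S) :
    ∃ (ι : (Fin (n + 1) → k.K) →ₛₗ[ramifyHom k l'] (Fin (n + 1) → k.K))
      (Ψ' : (Fin (n + 1) → k.K) →+ (Fin (n + 1) → k.K)) (S : Multiset ℚ), IsScalarExtension ι ∧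
        (∀ (a : k.K) x, Ψ' (a • x) = sigma k c' a • Ψ' x) ∧ (∀ x, Ψ' (ι x) = ι (Ψ x)) ∧
        SlopeChain val Ψ' ⊥ ⊤ S := by
  obtain ⟨ι, Ψ', hι, hΨ', hΨ'ι⟩ := exists_scalarExtension (φ := ramifyHom k l') hc
    (Pi.basisFun k.K (Fin (n + 1))) Ψ hΨ
  refine ⟨ι, Ψ', {val (ramifyHom k l' a)} + S, hι, hΨ', hΨ'ι, ?_⟩
  obtain ⟨g, hg⟩ := hι.exists_lift (ιQ.comp π)
  have hg : ∀ y, g (ι y) = ιQ (π y) := hg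
  have hgΨ : ∀ y, g (Ψ' y) = ΨQ (g y) := hι.ext_of_semilinear (ρ := sigma k c')
    (by simp) (by simp [hΨ']) (by simp) (by simp [hΨQ]) (by simp [hΨ'ι, hg, hπΨ, hΨQι])
  have hgs : Function.Surjective g := by
    rw [← LinearMap.range_eq_top, eq_top_iff, ← hιQ.span_range, Submodule.span_le]
    rintro _ ⟨y, rfl⟩
    obtain ⟨y, rfl⟩ := hπs y
    exact ⟨ι y, hg y⟩
  have hιx : ι x ≠ 0 := fun h => hx (hι.injective (by rw [h, map_zero]))
  -- The kernel contains the extended eigenvector, and it is a line by counting dimensions.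
  have hker : LinearMap.ker g = ⊥ ⊔ Submodule.span k.K {ι x} := by
    rw [bot_sup_eq]
    symm
    refine Submodule.eq_of_le_of_finrank_eq ?_ ?_
    · rw [Submodule.span_singleton_le_iff_mem, LinearMap.mem_ker, hg, hπ, map_zero]
    · have h1 := g.finrank_range_add_finrank_ker
      rw [LinearMap.range_eq_top.mpr hgs, finrank_top, hιQ.finrank_eq, hQ,
        Module.finrank_fin_fun] at h1
      rw [finrank_span_singleton hιx]
      omega
  have h1 : SlopeChain val Ψ' ⊥ (⊥ ⊔ Submodule.span k.K {ι x}) {val (ramifyHom k l' a)} := by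
    refine SlopeChain.single _ _ (by simpa using hιx) ((map_ne_zero _).mpr ha) ?_
    rw [hΨ'ι, hxa, map_smulₛₗ, sub_self]
    exact Submodule.zero_mem _
  have h2 := hS.comap (Φ := Ψ') g hgs hgΨ
  rw [Submodule.comap_top, Submodule.comap_bot, hker] at h2
  exact h1.trans h2

/-- After ramification, every `q`-difference module is triangularisable. -/
theorem exists_slopeChain (k : BaseField) (n : ℕ) : ∀ (τ : ℂ), 1 < ‖(qOf τ : ℂ)‖ →
    ∀ (M : Type) [AddCommGroup M] [Module k.K M] [FiniteDimensional k.K M] (Φ : M →+ M),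
      (∀ (a : k.K) x, Φ (a • x) = sigma k (qOf τ) a • Φ x) → Function.Surjective Φ →
      Module.finrank k.K M = n →
      ∃ (l : ℕ+) (ι : M →ₛₗ[ramifyHom k l] (Fin n → k.K)) (Ψ : (Fin n → k.K) →+ (Fin n → k.K))
        (S : Multiset ℚ), IsScalarExtension ι ∧
        (∀ (a : k.K) x, Ψ (a • x) = sigma k (qRoot τ l) a • Ψ x) ∧ (∀ x, Ψ (ι x) = ι (Φ x)) ∧
        SlopeChain (slopeVal k l) Ψ ⊥ ⊤ S := by
  induction n with
  | zero =>
    intro τ hq M _ _ _ Φ hΦ _ hn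
    obtain ⟨ι, Ψ, hι, hΨ, hΨι⟩ := exists_scalarExtension (φ := ramifyHom k 1)
      (sigma_ramifyHom k τ 1) (Module.finBasisOfFinrankEq k.K M hn) Φ hΦ
    refine ⟨1, ι, Ψ, 0, hι, hΨ, hΨι, ?_⟩
    rw [Subsingleton.elim (⊤ : Submodule k.K (Fin 0 → k.K)) ⊥]
    exact SlopeChain.refl _
  | succ n ih =>
    intro τ hq M _ _ _ Φ hΦ hs hn
    have : Nontrivial M := Module.nontrivial_of_finrank_pos (R := k.K) (by omega)
    obtain ⟨l, hl⟩ := exists_eigenvector hq Φ hΦ hs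
    obtain ⟨ι, Ψ, hι, hΨ, hΨι⟩ := exists_scalarExtension (φ := ramifyHom k l)
      (sigma_ramifyHom k τ l) (Module.finBasisOfFinrankEq k.K M hn) Φ hΦ
    obtain ⟨x, a, hx, ha, hxa⟩ := hl _ ι Ψ hι hΨ hΨι
    have hq' : qOf (τ / (l : ℕ)) = qRoot τ l := by rw [qOf, qRoot_div, mul_one]
    let p := Submodule.span k.K {x}
    let Ψ' : (Fin (n + 1) → k.K) →ₛₗ[(sigma k (qRoot τ l) : k.K →+* k.K)] (Fin (n + 1) → k.K) :=
      { Ψ with map_smul' := hΨ }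
    have hp : p ≤ p.comap Ψ' := by
      rw [Submodule.span_singleton_le_iff_mem, Submodule.mem_comap]
      change Ψ x ∈ p
      rw [hxa]
      exact Submodule.smul_mem _ _ (Submodule.mem_span_singleton_self x)
    let Φ' : (_ ⧸ p) →ₛₗ[(sigma k (qRoot τ l) : k.K →+* k.K)] (_ ⧸ p) := p.mapQ p Ψ' hp
    have hΦ' : ∀ y, Φ' (p.mkQ y) = p.mkQ (Ψ y) := fun y => rfl
    have hfin : Module.finrank k.K (_ ⧸ p) = n := by
      have h1 := p.finrank_quotient_add_finrank
      rw [finrank_span_singleton hx, Module.finrank_fin_fun] at h1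
      omega
    -- The quotient by the eigenvector lives over `K_l`, which is viewed as a base field with
    -- parameter `τ / l`; the induction hypothesis may ramify again, by `l'`.
    obtain ⟨l', ιQ, ΨQ, S, hιQ, hΨQ, hΨQι, hS⟩ := ih (τ / (l : ℕ))
      (hq' ▸ one_lt_norm_qRoot hq l) (_ ⧸ p) Φ'.toAddMonoidHom
      (fun b y => by rw [hq']; exact Φ'.map_smulₛₗ b y)
      (by
        intro y
        obtain ⟨y, rfl⟩ := p.mkQ_surjective y
        obtain ⟨y, rfl⟩ := hι.surjective hs hΨ hΨι y
        exact ⟨p.mkQ y, hΦ' y⟩) hfin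
    have hc : ∀ b, sigma k (qRoot τ (l * l')) (ramifyHom k l' b) =
        ramifyHom k l' (sigma k (qRoot τ l) b) := by
      intro b
      rw [← qRoot_div, sigma_ramifyHom, hq']
    rw [qRoot_div] at hΨQ
    obtain ⟨ι', Ψ'', T, hι', hΨ'', hΨι', hT⟩ := exists_slopeChain_of_quotient hc Ψ hΨ hx ha hxa
      p.mkQ ((Submodule.Quotient.mk_eq_zero p).mpr (Submodule.mem_span_singleton_self x))
      p.mkQ_surjective (fun y => (hΦ' y).symm) hfin hιQ hΨQ hΨQι hS
    let ι'' : M →ₛₗ[ramifyHom k (l * l')] (Fin (n + 1) → k.K) :=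
      { toFun := fun y => ι' (ι y)
        map_add' := fun y z => by simp
        map_smul' := fun b y => by simp [ramifyHom_ramifyHom] }
    have hT' : SlopeChain (slopeVal k (l * l')) Ψ'' ⊥ ⊤ (T.map fun s => s / ((l : ℕ) : ℚ)) :=
      hT.map_val _ fun b _ => slopeVal_mul_right k l l' b
    exact ⟨l * l', ι'', Ψ'', _, hι.trans hι' fun _ => rfl, hΨ'',
      fun y => by simp [ι'', hΨι', hΨι], hT'⟩

end Existence

/-! ### The multiset of slopes of a `q`-difference module -/

section Slopes

universe u

variable {k : BaseField} {τ : ℂ} {M : Type u} [AddCommGroup M] [Module k.K M]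

/-- The difference module `K_l ⊗ M` over `K_l`. -/
abbrev ramifiedAut (l : ℕ+) (Φ : M ≃ₛₗ[(sigma k (qOf τ) : k.K →+* k.K)] M) :=
  baseChangeAut (sigmaRamified k τ l) (sigmaRamified_algebraMap k τ l) Φ

/-- The slope `v₀(a) / l` of `a ∈ K_l`. -/
def Ramified.slope {l : ℕ+} (a : Ramified k l) : ℚ := (a.v₀ : ℚ) / (l : ℕ)

/-- `K_l ⊗ M` is triangularisable, with slopes `S`. -/
def HasSlopes (Φ : M ≃ₛₗ[(sigma k (qOf τ) : k.K →+* k.K)] M) (l : ℕ+) (S : Multiset ℚ) : Prop :=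
  SlopeChain (Ramified.slope (k := k) (l := l)) (ramifiedAut l Φ) ⊥ ⊤ S

namespace Ramified

variable {l : ℕ+}

lemma slope_mul {a b : Ramified k l} (ha : a ≠ 0) (hb : b ≠ 0) :
    slope (a * b) = slope a + slope b := by
  have h : (a * b).v₀ = a.v₀ + b.v₀ := BaseField.v₀_mul (k := k) ha hb
  rw [slope, slope, slope, h, Int.cast_add, add_div]

lemma slope_inv {a : Ramified k l} (ha : a ≠ 0) : slope a⁻¹ = -slope a := by
  have h : (a⁻¹).v₀ = -a.v₀ := BaseField.v₀_inv (k := k) ha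
  rw [slope, slope, h, Int.cast_neg, neg_div]

lemma slope_sigma (a : Ramified k l) : slope (sigmaRamified k τ l a) = slope a := by
  have h : (sigmaRamified k τ l a).v₀ = a.v₀ := BaseField.v₀_sigma (k := k) _ a
  rw [slope, slope, h]

lemma slope_mul_sigma_div (a c : Ramified k l) (hc : c ≠ 0) :
    slope (a * (sigmaRamified k τ l c / c)) = slope a := by
  by_cases ha : a = 0
  · rw [ha, zero_mul]
  have hσ : sigmaRamified k τ l c ≠ 0 := (map_ne_zero _).mpr hc
  rw [slope_mul ha (div_ne_zero hσ hc), div_eq_mul_inv, slope_mul hσ (inv_ne_zero hc),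
    slope_inv hc, slope_sigma, add_neg_cancel, add_zero]

end Ramified

instance (l : ℕ+) [FiniteDimensional k.K M] :
    FiniteDimensional (Ramified k l) (Ramified k l ⊗[k.K] M) :=
  Module.Finite.base_change _ _ _

lemma toFinsupp_map_univ {n : ℕ} (f : Fin n → ℚ) :
    Multiset.toFinsupp (Finset.univ.val.map f) = ∑ i, Finsupp.single (f i) 1 := by
  have h1 : Finset.univ.val.map f = ∑ i, ({f i} : Multiset ℚ) := by
    rw [← Multiset.sum_map_singleton (Finset.univ.val.map f), Multiset.map_map]
    rfl
  rw [h1, map_sum]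
  exact Finset.sum_congr rfl fun i _ => Multiset.toFinsupp_singleton _

lemma isNewtonFunction_iff [FiniteDimensional k.K M]
    (Φ : M ≃ₛₗ[(sigma k (qOf τ) : k.K →+* k.K)] M) (r : ℚ →₀ ℕ) :
    IsNewtonFunction Φ r ↔ ∃ l S, HasSlopes Φ l S ∧ r = Multiset.toFinsupp S := by
  constructor
  · rintro ⟨l, n, F, a, hF, rfl⟩
    exact ⟨l, _, hF.slopeChain Ramified.slope, (toFinsupp_map_univ _).symm⟩
  · rintro ⟨l, S, h, rfl⟩
    obtain ⟨n, F, a, hF, rfl⟩ := h.exists_isTriangularisation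
    exact ⟨l, n, F, a, hF, toFinsupp_map_univ _⟩

/-- The map `M → K_l ⊗ M`, `x ↦ 1 ⊗ x`. -/
def ramifiedMk (k : BaseField) (M : Type u) [AddCommGroup M] [Module k.K M] (l : ℕ+) :
    M →ₛₗ[algebraMap k.K (Ramified k l)] Ramified k l ⊗[k.K] M where
  toFun x := 1 ⊗ₜ x
  map_add' x y := TensorProduct.tmul_add _ _ _
  map_smul' c x := by
    rw [TensorProduct.tmul_smul, algebraMap_smul]

/-- In coordinates the module is `K^n`, and its triangularisation is obtained over a copy of `K`
with scalars embedded by `z ↦ z ^ l`. That coordinate model and `K_l ⊗ M` are two extensions of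
scalars of `M`, hence they have the same slopes. -/
theorem exists_hasSlopes [FiniteDimensional k.K M] (hq : 1 < ‖(qOf τ : ℂ)‖)
    (Φ : M ≃ₛₗ[(sigma k (qOf τ) : k.K →+* k.K)] M) : ∃ l S, HasSlopes Φ l S := by
  let e : M ≃ₗ[k.K] (Fin (Module.finrank k.K M) → k.K) := (Module.finBasis k.K M).equivFun
  let Φ₀ : (Fin (Module.finrank k.K M) → k.K) →+ (Fin (Module.finrank k.K M) → k.K) :=
    { toFun := fun x => e (Φ (e.symm x))
      map_zero' := by simp
      map_add' := fun x y => by simp }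
  have hΦ₀ : ∀ x, Φ₀ (e x) = e (Φ x) := fun x => by simp [Φ₀]
  obtain ⟨l, ι, Ψ, S, hι, hΨ, hΨι, hS⟩ := exists_slopeChain k (Module.finrank k.K M) τ hq _ Φ₀
    (fun a x => by simp [Φ₀, map_smulₛₗ])
    (fun y => ⟨e (Φ.symm (e.symm y)), by simp [hΦ₀]⟩) (by simp)
  refine ⟨l, S, ?_⟩
  -- As a field `Ramified k l` is `k.K`, so the coordinate space is a vector space over it.
  let _ : Module (Ramified k l) (Fin (Module.finrank k.K M) → k.K) :=
    inferInstanceAs (Module k.K (Fin (Module.finrank k.K M) → k.K))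
  let ι' : M →ₛₗ[algebraMap k.K (Ramified k l)] (Fin (Module.finrank k.K M) → k.K) :=
    { toFun := fun x => ι (e x)
      map_add' := fun x y => by simp
      map_smul' := fun c x => by
        rw [map_smul]
        exact ι.map_smulₛₗ c (e x) }
  have hι' : IsScalarExtension ι' := by
    intro n b
    exact hι (b.map e)
  exact SlopeChain.congr_scalarExtension (L := Ramified k l) hι'
    (isScalarExtension_mk (ramifiedMk k M l) fun _ => rfl) (Φ := Φ)
    (ρ := sigmaRamified k τ l) (Ψ := Ψ) (map_add Ψ) hΨ
    (fun x => by
      change Ψ (ι (e x)) = ι (e (Φ x))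
      rw [hΨι, hΦ₀])
    (map_add (ramifiedAut l Φ)) (map_smulₛₗ (ramifiedAut l Φ))
    (fun x => by
      change ramifiedAut l Φ (1 ⊗ₜ x) = 1 ⊗ₜ Φ x
      rw [baseChangeAut_tmul, map_one]) hS

/-- The embedding `K_l → K_{l l'}`. -/
def Ramified.hom (k : BaseField) (l l' : ℕ+) : Ramified k l →+* Ramified k (l * l') :=
  ramifyHom k l'

/-- The map `K_l ⊗ M → K_{l l'} ⊗ M`. -/
def ramifiedMap (k : BaseField) (M : Type u) [AddCommGroup M] [Module k.K M] (l l' : ℕ+) :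
    Ramified k l ⊗[k.K] M →ₛₗ[Ramified.hom k l l'] Ramified k (l * l') ⊗[k.K] M :=
  let φ : Ramified k l →ₗ[k.K] Ramified k (l * l') :=
    { Ramified.hom k l l' with
      map_smul' := fun c x => by
        simp only [Algebra.smul_def]
        exact (map_mul (Ramified.hom k l l') _ _).trans
          (congrArg (· * Ramified.hom k l l' x) (ramifyHom_ramifyHom l l' c)) }
  { φ.rTensor M with
    map_smul' := fun a t => by
      change φ.rTensor M (a • t) = Ramified.hom k l l' a • φ.rTensor M t
      induction t with
      | zero => simp
      | add x y hx hy => rw [smul_add, map_add, map_add, smul_add, hx, hy]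
      | tmul b x =>
        rw [TensorProduct.smul_tmul', LinearMap.rTensor_tmul, LinearMap.rTensor_tmul,
          TensorProduct.smul_tmul', smul_eq_mul, smul_eq_mul]
        exact congrArg (· ⊗ₜ x) (map_mul (Ramified.hom k l l') a b) }

lemma ramifiedMap_tmul (l l' : ℕ+) (b : Ramified k l) (x : M) :
    ramifiedMap k M l l' (b ⊗ₜ x) = Ramified.hom k l l' b ⊗ₜ x := rfl

/-- Extending scalars from `K_l` to `K_{l l'}` multiplies valuations by `l'`, which the denominator
`l l'` compensates. -/
lemma HasSlopes.mul_right [FiniteDimensional k.K M]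
    {Φ : M ≃ₛₗ[(sigma k (qOf τ) : k.K →+* k.K)] M} {l : ℕ+} {S : Multiset ℚ}
    (h : HasSlopes Φ l S) (l' : ℕ+) : HasSlopes Φ (l * l') S := by
  refine SlopeChain.scalarExtension_top (φ := Ramified.hom k l l')
    (fun a _ => slopeVal_ramifyHom k l l' a) (ι := ramifiedMap k M l l') ?_ ?_ h
  · refine .of_basis (b := (Module.finBasis k.K M).baseChange (Ramified k l))
      (b' := (Module.finBasis k.K M).baseChange (Ramified k (l * l'))) fun i => ?_
    rw [Module.Basis.baseChange_apply, Module.Basis.baseChange_apply, ramifiedMap_tmul, map_one]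
  · intro t
    induction t with
    | zero => simp
    | add x y hx hy => rw [map_add, map_add, map_add, map_add, hx, hy]
    | tmul b x =>
      rw [ramifiedMap_tmul, baseChangeAut_tmul, baseChangeAut_tmul, ramifiedMap_tmul]
      congr 1
      have := sigma_ramifyHom k (τ / (l : ℕ)) l' b
      rw [qRoot_div, qOf, qRoot_div, mul_one] at this
      exact this

/-- Both chains are extended to level `l l'`, where Jordan–Hölder applies because `σ c / c` has
valuation `0`. -/
lemma HasSlopes.unique [FiniteDimensional k.K M]
    {Φ : M ≃ₛₗ[(sigma k (qOf τ) : k.K →+* k.K)] M} {l l' : ℕ+} {S T : Multiset ℚ}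
    (h : HasSlopes Φ l S) (h' : HasSlopes Φ l' T) : S = T := by
  have h1 := h.mul_right l'
  have h2 := h'.mul_right l
  rw [mul_comm] at h2
  exact SlopeChain.unique Ramified.slope_mul_sigma_div h1 h2

lemma HasSlopes.newtonFunction_eq [FiniteDimensional k.K M]
    {Φ : M ≃ₛₗ[(sigma k (qOf τ) : k.K →+* k.K)] M} {l : ℕ+} {S : Multiset ℚ}
    (h : HasSlopes Φ l S) : newtonFunction Φ = Multiset.toFinsupp S := by
  have hex : ∃ r, IsNewtonFunction Φ r := ⟨_, (isNewtonFunction_iff Φ _).mpr ⟨l, S, h, rfl⟩⟩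
  rw [newtonFunction, dif_pos hex]
  obtain ⟨l', T, hT, hr⟩ := (isNewtonFunction_iff Φ _).mp hex.choose_spec
  rw [hr, hT.unique h]

end Slopes

/-! ### Slopes of extensions, tensor products and duals of `q`-difference modules -/

section Operations

universe u₁ u₂ u₃

variable {k : BaseField} {τ : ℂ} {M : Type u₁} [AddCommGroup M] [Module k.K M]
  {N : Type u₂} [AddCommGroup N] [Module k.K N] {P : Type u₃} [AddCommGroup P] [Module k.K P]
  {Φ : M ≃ₛₗ[(sigma k (qOf τ) : k.K →+* k.K)] M} {Ψ : N ≃ₛₗ[(sigma k (qOf τ) : k.K →+* k.K)] N}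
  {Θ : P ≃ₛₗ[(sigma k (qOf τ) : k.K →+* k.K)] P} {l : ℕ+} {S T : Multiset ℚ}

lemma baseChange_ramifiedAut (f : M →ₗ[k.K] N) (hf : ∀ x, f (Φ x) = Ψ (f x))
    (t : Ramified k l ⊗[k.K] M) :
    f.baseChange (Ramified k l) (ramifiedAut l Φ t) =
      ramifiedAut l Ψ (f.baseChange (Ramified k l) t) := by
  induction t with
  | zero => simp
  | add x y hx hy => rw [map_add, map_add, map_add, map_add, hx, hy]
  | tmul b x =>
    rw [baseChangeAut_tmul, LinearMap.baseChange_tmul, LinearMap.baseChange_tmul,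
      baseChangeAut_tmul, hf]

/-- Extension of scalars to `K_l` preserves short exact sequences, by flatness, and intertwines the
automorphisms. -/
lemma HasSlopes.of_exact (f : M →ₗ[k.K] N) (g : N →ₗ[k.K] P)
    (hf : Function.Injective f) (hfg : Function.Exact f g) (hg : Function.Surjective g)
    (hfΦ : ∀ x, f (Φ x) = Ψ (f x)) (hgΦ : ∀ x, g (Ψ x) = Θ (g x))
    (h : HasSlopes Φ l S) (h' : HasSlopes Θ l T) : HasSlopes Ψ l (S + T) := by
  refine SlopeChain.of_exact (f.baseChange (Ramified k l)) (g.baseChange (Ramified k l)) ?_ ?_ ?_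
    (baseChange_ramifiedAut f hfΦ) (baseChange_ramifiedAut g hgΦ) h h'
  · exact Module.Flat.lTensor_preserves_injective_linearMap (M := Ramified k l) f hf
  · exact lTensor_exact (Ramified k l) hfg hg
  · exact LinearMap.lTensor_surjective (Ramified k l) hg

/-- The product chain lives on `(K_l ⊗ M) ⊗ (K_l ⊗ N)`; it is carried to `K_l ⊗ (M ⊗ N)` by an
isomorphism compatible with the automorphisms. -/
lemma HasSlopes.tensor (h : HasSlopes Φ l S) (h' : HasSlopes Ψ l T) :
    HasSlopes (tensorAut Φ Ψ) l (S.bind fun s => T.map (s + ·)) := by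
  have h1 := SlopeChain.tensor (fun a b => Ramified.slope_mul) h h'
  have htop : Submodule.map₂ (TensorProduct.mk (Ramified k l) (Ramified k l ⊗[k.K] M)
      (Ramified k l ⊗[k.K] N)) ⊤ ⊤ = ⊤ := TensorProduct.map₂_mk_top_top_eq_top _ _ _
  rw [Submodule.map₂_bot_left, htop] at h1
  let e := TensorProduct.AlgebraTensorModule.distribBaseChange k.K (Ramified k l) M N
  have he : ∀ x, e (ramifiedAut l (tensorAut Φ Ψ) x) =
      tensorAut (ramifiedAut l Φ) (ramifiedAut l Ψ) (e x) := by
    intro t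
    induction t with
    | zero => simp
    | add x y hx hy => rw [map_add, map_add, map_add, map_add, hx, hy]
    | tmul b x =>
      induction x with
      | zero => simp
      | add x y hx hy => simp only [TensorProduct.tmul_add, map_add, hx, hy]
      | tmul x y =>
        simp [e]
  refine h1.congr e.symm fun x => ?_
  rw [LinearEquiv.symm_apply_eq, he, LinearEquiv.apply_symm_apply]

/-- The extension of scalars of a linear form. -/
def ramifiedDual (k : BaseField) (M : Type u₁) [AddCommGroup M] [Module k.K M] (l : ℕ+) :
    Module.Dual k.K M →ₛₗ[algebraMap k.K (Ramified k l)]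
      Module.Dual (Ramified k l) (Ramified k l ⊗[k.K] M) where
  toFun u := Module.Dual.baseChange (Ramified k l) u
  map_add' u v := map_add _ u v
  map_smul' c u := by
    rw [map_smul, algebraMap_smul]

lemma ramifiedDual_tmul (u : Module.Dual k.K M) (b : Ramified k l) (x : M) :
    ramifiedDual k M l u (b ⊗ₜ x) = algebraMap k.K (Ramified k l) (u x) * b := by
  simp [ramifiedDual, Algebra.smul_def]

/-- The dual chain lives on the dual of `K_l ⊗ M`. This space and `K_l ⊗ M^∨` are both extensions of
scalars of `M^∨`, so the slopes carry over. -/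
lemma HasSlopes.dual [FiniteDimensional k.K M] (h : HasSlopes Φ l S) :
    HasSlopes (dualAut Φ) l (S.map (- ·)) := by
  have h1 := SlopeChain.dual (fun a => Ramified.slope_inv) h (by simp)
  rw [Submodule.dualAnnihilator_top, Submodule.dualAnnihilator_bot] at h1
  have hι : IsScalarExtension (ramifiedDual k M l) := by
    refine .of_basis (b := (Module.finBasis k.K M).dualBasis)
      (b' := ((Module.finBasis k.K M).baseChange (Ramified k l)).dualBasis) fun i => ?_
    refine ((Module.finBasis k.K M).baseChange (Ramified k l)).ext fun j => ?_
    rw [Module.Basis.dualBasis_apply_self, Module.Basis.baseChange_apply, ramifiedDual_tmul,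
      Module.Basis.dualBasis_apply_self]
    split_ifs <;> simp
  refine SlopeChain.congr_scalarExtension hι
    (isScalarExtension_mk (ramifiedMk k (Module.Dual k.K M) l) fun _ => rfl) (Φ := dualAut Φ)
    (ρ := sigmaRamified k τ l) (map_add (dualAut (ramifiedAut l Φ)))
    (map_smulₛₗ (dualAut (ramifiedAut l Φ))) (fun u => ?_)
    (map_add (ramifiedAut l (dualAut Φ))) (map_smulₛₗ (ramifiedAut l (dualAut Φ)))
    (fun u => ?_) h1
  · refine ((Module.finBasis k.K M).baseChange (Ramified k l)).ext fun j => ?_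
    have hsymm : ∀ x : M, (ramifiedAut l Φ).symm (1 ⊗ₜ x) = 1 ⊗ₜ Φ.symm x := by
      intro x
      rw [LinearEquiv.symm_apply_eq, baseChangeAut_tmul, map_one, LinearEquiv.apply_symm_apply]
    rw [Module.Basis.baseChange_apply, dualAut_apply, hsymm, ramifiedDual_tmul, ramifiedDual_tmul,
      mul_one, mul_one, sigmaRamified_algebraMap, dualAut_apply]
  · change ramifiedAut l (dualAut Φ) (1 ⊗ₜ u) = 1 ⊗ₜ dualAut Φ u
    rw [baseChangeAut_tmul, map_one]

/-- For each `s` the slope `μ` arises from `T` exactly at `μ - s`, so the multiplicity is a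
convolution. -/
lemma count_bind_add (S T : Multiset ℚ) (μ : ℚ) :
    (S.bind fun s => T.map (s + ·)).count μ =
      ∑ p ∈ S.toFinset ×ˢ T.toFinset with p.1 + p.2 = μ, S.count p.1 * T.count p.2 := by
  rw [Multiset.count_bind, Finset.sum_multiset_map_count, Finset.sum_filter, Finset.sum_product]
  refine Finset.sum_congr rfl fun s _ => ?_
  have h1 : (T.map (s + ·)).count μ = T.count (μ - s) := by
    have := Multiset.count_map_eq_count' (s + ·) T (add_right_injective s) (μ - s)
    rwa [add_sub_cancel] at this
  rw [h1, smul_eq_mul]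
  have h2 : ∀ t, s + t = μ ↔ t = μ - s := fun t => by rw [eq_sub_iff_add_eq, add_comm]
  simp only [h2, Finset.sum_ite_eq', Multiset.mem_toFinset]
  split_ifs with h
  · rfl
  · rw [Multiset.count_eq_zero_of_notMem h, mul_zero]

end Operations

/-! ### Polygons -/

section Polygon

/-- The length of the part of the polygon with slopes `< t`. -/
def polygonX (r : ℚ →₀ ℕ) (t : ℚ) : ℝ := ∑ μ ∈ r.support with μ < t, (r μ : ℝ)

/-- The height of the polygon at the abscissa `polygonX r t`. -/
def polygonY (r : ℚ →₀ ℕ) (t : ℚ) : ℝ := ∑ μ ∈ r.support with μ < t, (r μ : ℝ) * (μ : ℝ)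

/-- The total length of the polygon. -/
def polygonLength (r : ℚ →₀ ℕ) : ℝ := r.sum fun _ n => (n : ℝ)

/-- The maximum of `t x - y` on the polygon. -/
def polygonSupport (r : ℚ →₀ ℕ) (t : ℚ) : ℝ := r.sum fun μ n => (n : ℝ) * max ((t : ℝ) - μ) 0

variable (r : ℚ →₀ ℕ)

lemma polygon_eq : polygon r = convexHull ℝ {p | ∃ t, p.1 = polygonX r t ∧ polygonY r t ≤ p.2} :=
  rfl

lemma polygonLength_add (r' : ℚ →₀ ℕ) :
    polygonLength (r + r') = polygonLength r + polygonLength r' :=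
  Finsupp.sum_add_index' (by simp) (by simp)

lemma polygonSupport_add (r' : ℚ →₀ ℕ) (t : ℚ) :
    polygonSupport (r + r') t = polygonSupport r t + polygonSupport r' t :=
  Finsupp.sum_add_index' (by simp) (by simp [add_mul])

lemma polygonX_add (r' : ℚ →₀ ℕ) (t : ℚ) :
    polygonX (r + r') t = polygonX r t + polygonX r' t := by
  have h : ∀ r : ℚ →₀ ℕ, polygonX r t = r.sum fun μ n => if μ < t then (n : ℝ) else 0 :=
    fun r => Finset.sum_filter _ _
  rw [h, h, h]
  exact Finsupp.sum_add_index' (by simp) fun μ m n => by split_ifs <;> simp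

lemma polygonY_add (r' : ℚ →₀ ℕ) (t : ℚ) :
    polygonY (r + r') t = polygonY r t + polygonY r' t := by
  have h : ∀ r : ℚ →₀ ℕ, polygonY r t = r.sum fun μ n => if μ < t then (n : ℝ) * (μ : ℝ) else 0 :=
    fun r => Finset.sum_filter _ _
  rw [h, h, h]
  exact Finsupp.sum_add_index' (by simp) fun μ m n => by split_ifs <;> simp [add_mul]

lemma polygonX_nonneg (t : ℚ) : 0 ≤ polygonX r t :=
  Finset.sum_nonneg fun _ _ => Nat.cast_nonneg _

lemma polygonX_le_length (t : ℚ) : polygonX r t ≤ polygonLength r :=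
  Finset.sum_le_sum_of_subset_of_nonneg (Finset.filter_subset _ _) fun _ _ _ => Nat.cast_nonneg _

lemma mul_polygonX_sub_polygonY (s t : ℚ) :
    (s : ℝ) * polygonX r t - polygonY r t =
      ∑ μ ∈ r.support with μ < t, (r μ : ℝ) * ((s : ℝ) - μ) := by
  rw [polygonX, polygonY, Finset.mul_sum, ← Finset.sum_sub_distrib]
  exact Finset.sum_congr rfl fun μ _ => by ring

lemma mul_polygonX_sub_polygonY_le (s t : ℚ) :
    (s : ℝ) * polygonX r t - polygonY r t ≤ polygonSupport r s := by
  rw [mul_polygonX_sub_polygonY]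
  refine (Finset.sum_le_sum fun μ _ => ?_).trans
    (Finset.sum_le_sum_of_subset_of_nonneg (Finset.filter_subset _ _) fun μ _ _ => ?_)
  · exact mul_le_mul_of_nonneg_left (le_max_left _ 0) (Nat.cast_nonneg _)
  · positivity

/-- The positive part of `t - μ` keeps exactly the slopes below `t`, so the maximum of `t x - y` is
attained at the vertex of parameter `t`. -/
lemma polygonSupport_eq (t : ℚ) :
    polygonSupport r t = (t : ℝ) * polygonX r t - polygonY r t := by
  rw [mul_polygonX_sub_polygonY, Finset.sum_filter]
  refine Finset.sum_congr rfl fun μ _ => ?_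
  split_ifs with h
  · change (r μ : ℝ) * max ((t : ℝ) - μ) 0 = _
    rw [max_eq_left]
    have : (μ : ℝ) < t := by exact_mod_cast h
    linarith
  · change (r μ : ℝ) * max ((t : ℝ) - μ) 0 = _
    rw [max_eq_right, mul_zero]
    have : (t : ℝ) ≤ μ := by exact_mod_cast not_lt.mp h
    linarith

/-- Consecutive vertices around a given abscissa. -/
lemma exists_consecutive_vertices {x : ℝ} (h0 : 0 ≤ x) (hx : x ≤ polygonLength r) :
    ∃ (t t' : ℚ), polygonX r t ≤ x ∧ x ≤ polygonX r t' ∧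
      polygonX r t' = polygonX r t + r t ∧ polygonY r t' = polygonY r t + r t * t := by
  -- `t'` is the next slope after `t`, or any number beyond all slopes. Passing from parameter `t`
  -- to `t'` then crosses the slope `t` only.
  have hnext : ∀ t : ℚ, ∃ t', t < t' ∧ (∀ μ ∈ r.support, μ < t' → μ ≤ t) ∧
      (t' ∈ r.support ∨ ∀ μ ∈ r.support, μ < t') := by
    intro t
    by_cases hne : (r.support.filter (t < ·)).Nonempty
    · obtain ⟨t', hmem, hmin⟩ := Finset.exists_min_image _ id hne
      refine ⟨t', (Finset.mem_filter.mp hmem).2, fun μ hμ hlt => ?_,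
        Or.inl (Finset.mem_filter.mp hmem).1⟩
      by_contra hle
      exact absurd (hmin μ (Finset.mem_filter.mpr ⟨hμ, not_le.mp hle⟩)) (not_le.mpr hlt)
    · rw [Finset.not_nonempty_iff_eq_empty, Finset.filter_eq_empty_iff] at hne
      exact ⟨t + 1, by linarith, fun μ hμ _ => not_lt.mp (hne hμ),
        Or.inr fun μ hμ => (not_lt.mp (hne hμ)).trans_lt (by linarith)⟩
  have hsplit : ∀ t t' : ℚ, t < t' → (∀ μ ∈ r.support, μ < t' → μ ≤ t) → ∀ f : ℚ → ℝ,
      ∑ μ ∈ r.support with μ < t', (r μ : ℝ) * f μ =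
        ∑ μ ∈ r.support with μ < t, (r μ : ℝ) * f μ + r t * f t := by
    intro t t' htt' h f
    by_cases ht : t ∈ r.support
    · have : r.support.filter (· < t') = insert t (r.support.filter (· < t)) := by
        ext μ
        simp only [Finset.mem_filter, Finset.mem_insert]
        constructor
        · rintro ⟨hμ, hlt⟩
          rcases (h μ hμ hlt).eq_or_lt with rfl | h1
          · exact Or.inl rfl
          · exact Or.inr ⟨hμ, h1⟩
        · rintro (rfl | ⟨hμ, hlt⟩)
          · exact ⟨ht, htt'⟩
          · exact ⟨hμ, hlt.trans htt'⟩
      rw [this, Finset.sum_insert (by simp), add_comm]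
    · have : r.support.filter (· < t') = r.support.filter (· < t) := by
        refine Finset.filter_congr fun μ hμ => ⟨fun hlt => ?_, fun hlt => hlt.trans htt'⟩
        exact (h μ hμ hlt).lt_of_ne fun h1 => ht (h1 ▸ hμ)
      rw [this, Finsupp.notMem_support_iff.mp ht]
      simp
  have hfull : ∀ t, (∀ μ ∈ r.support, μ < t) → polygonX r t = polygonLength r := fun t h => by
    rw [polygonX, Finset.filter_true_of_mem h]
    rfl
  -- The largest slope whose edge begins at or before `x`. If there is none, the support is empty,
  -- since the edge of least slope begins at `0`; then `0` serves as `t`.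
  obtain ⟨t, htx, htmax⟩ : ∃ t, polygonX r t ≤ x ∧ ∀ μ ∈ r.support, t < μ → x < polygonX r μ := by
    by_cases hne : (r.support.filter (polygonX r · ≤ x)).Nonempty
    · obtain ⟨t, ht, hmax⟩ := Finset.exists_max_image _ id hne
      refine ⟨t, (Finset.mem_filter.mp ht).2, fun μ hμ hlt => ?_⟩
      by_contra hle
      exact absurd (hmax μ (Finset.mem_filter.mpr ⟨hμ, not_lt.mp hle⟩)) (not_le.mpr hlt)
    · rw [Finset.not_nonempty_iff_eq_empty, Finset.filter_eq_empty_iff] at hne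
      have hsupp : r.support = ∅ := by
        by_contra hne'
        have hne' := Finset.nonempty_iff_ne_empty.mpr hne'
        obtain ⟨t, ht, hmin⟩ := r.support.exists_min_image id hne'
        have hX : polygonX r t = 0 := by
          rw [polygonX, Finset.filter_false_of_mem, Finset.sum_empty]
          exact fun μ hμ => not_lt.mpr (hmin μ hμ)
        exact hne ht (hX.trans_le h0)
      refine ⟨0, ?_, fun μ hμ => by simp [hsupp] at hμ⟩
      rw [polygonX, hsupp]
      simpa using h0
  obtain ⟨t', htt', hbetween, hor⟩ := hnext t
  refine ⟨t, t', htx, ?_, ?_, ?_⟩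
  · rcases hor with h | h
    · exact (htmax t' h htt').le
    · rw [hfull t' h]
      exact hx
  · simpa [polygonX] using hsplit t t' htt' hbetween fun _ => 1
  · exact hsplit t t' htt' hbetween fun μ => μ

/-- The polygon is the intersection of the half-planes containing it. -/
theorem mem_polygon_iff (p : ℝ × ℝ) :
    p ∈ polygon r ↔ 0 ≤ p.1 ∧ p.1 ≤ polygonLength r ∧
      ∀ t : ℚ, (t : ℝ) * p.1 - p.2 ≤ polygonSupport r t := by
  rw [polygon_eq]
  constructor
  · intro hp
    have hconv : Convex ℝ {p : ℝ × ℝ | 0 ≤ p.1 ∧ p.1 ≤ polygonLength r ∧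
        ∀ t : ℚ, (t : ℝ) * p.1 - p.2 ≤ polygonSupport r t} := by
      rintro ⟨x, y⟩ ⟨h1, h2, h3⟩ ⟨x', y'⟩ ⟨h1', h2', h3'⟩ a b ha hb hab
      simp only [Set.mem_ofPred_eq, Prod.smul_mk, Prod.mk_add_mk, smul_eq_mul] at *
      refine ⟨by positivity, ?_, fun t => ?_⟩
      · calc a * x + b * x' ≤ a * polygonLength r + b * polygonLength r := by gcongr
          _ = polygonLength r := by rw [← add_mul, hab, one_mul]
      · calc (t : ℝ) * (a * x + b * x') - (a * y + b * y') =
            a * (t * x - y) + b * (t * x' - y') := by ring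
          _ ≤ a * polygonSupport r t + b * polygonSupport r t := by
            gcongr
            exacts [h3 t, h3' t]
          _ = polygonSupport r t := by rw [← add_mul, hab, one_mul]
    refine convexHull_min ?_ hconv hp
    rintro ⟨x, y⟩ ⟨t, hx, hy⟩
    simp only at hx hy
    subst hx
    refine ⟨polygonX_nonneg r t, polygonX_le_length r t, fun s => ?_⟩
    have := mul_polygonX_sub_polygonY_le r s t
    simp only
    linarith
  · rintro ⟨h0, hx, hsup⟩
    obtain ⟨x, y⟩ := p
    simp only at h0 hx hsup
    obtain ⟨t, t', htx, hxt', hX, hY⟩ := exists_consecutive_vertices r h0 hx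
    -- Only the half-plane bounded by the edge of slope `t` is needed. It says that the point is at
    -- some height `h ≥ 0` above that edge, hence it is a convex combination of the two end vertices
    -- raised by `h`.
    have hsup := hsup t
    rw [polygonSupport_eq] at hsup
    have hmem : ∀ s (h : ℝ), 0 ≤ h → (polygonX r s, polygonY r s + h) ∈
        convexHull ℝ {p : ℝ × ℝ | ∃ t, p.1 = polygonX r t ∧ polygonY r t ≤ p.2} := fun s h hh =>
      subset_convexHull ℝ _ ⟨s, rfl, by simpa using hh⟩
    set h := y - (polygonY r t + t * (x - polygonX r t)) with hh
    have hh0 : 0 ≤ h := by rw [hh]; linarith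
    -- When `t` is not a slope the edge has length zero and the point lies on a single vertical
    -- half-line.
    rcases eq_or_ne (r t : ℝ) 0 with hr | hr
    · have hxX : x = polygonX r t := le_antisymm (by rw [hX, hr, add_zero] at hxt'; exact hxt') htx
      have : (x, y) = (polygonX r t, polygonY r t + h) := by
        rw [hh, hxX]
        simp
      rw [this]
      exact hmem t h hh0
    · have hr0 : (0 : ℝ) < r t := lt_of_le_of_ne (Nat.cast_nonneg _) hr.symm
      have hb0 : 0 ≤ (x - polygonX r t) / r t := div_nonneg (by linarith) hr0.le
      have hb1 : 0 ≤ 1 - (x - polygonX r t) / r t := by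
        rw [sub_nonneg, div_le_one hr0]
        linarith
      have := (convex_convexHull ℝ _) (hmem t h hh0) (hmem t' h hh0) hb1 hb0 (by ring)
      convert this using 1
      rw [hX, hY]
      ext
      · simp only [Prod.smul_mk, Prod.mk_add_mk, smul_eq_mul]
        field_simp
        ring
      · simp only [Prod.smul_mk, Prod.mk_add_mk, smul_eq_mul, hh]
        field_simp
        ring

/-- Polygons add up under Minkowski sum. -/
theorem polygon_add (r' : ℚ →₀ ℕ) : polygon (r + r') = polygon r + polygon r' := by
  refine Set.Subset.antisymm ?_ ?_
  -- A vertex of the sum with parameter `t` is the sum of the vertices with the same `t`; the second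
  -- summand absorbs the excess height.
  · refine convexHull_min ?_ ((convex_convexHull ℝ _).add (convex_convexHull ℝ _))
    rintro ⟨x, y⟩ ⟨t, hx, hy⟩
    change x = polygonX (r + r') t at hx
    change polygonY (r + r') t ≤ y at hy
    rw [polygonX_add] at hx
    rw [polygonY_add] at hy
    refine Set.mem_add.mpr ⟨(polygonX r t, polygonY r t),
      subset_convexHull ℝ _ ⟨t, rfl, le_rfl⟩, (polygonX r' t, y - polygonY r t),
      subset_convexHull ℝ _ ⟨t, rfl, ?_⟩, ?_⟩
    · change polygonY r' t ≤ y - polygonY r t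
      linarith
    · rw [Prod.mk_add_mk, hx, add_sub_cancel]
  -- Conversely, the inequalities defining the two polygons add up, since length and support
  -- function are additive.
  · rintro _ ⟨p, hp, p', hp', rfl⟩
    rw [mem_polygon_iff] at hp hp'
    obtain ⟨h1, h2, h3⟩ := hp
    obtain ⟨h1', h2', h3'⟩ := hp'
    simp only [mem_polygon_iff, polygonLength_add, polygonSupport_add, Prod.fst_add, Prod.snd_add]
    refine ⟨by linarith, by linarith, fun t => ?_⟩
    have := h3 t
    have := h3' t
    linarith

end Polygon

end QDiff

end

/-! ### The theorem: reduction to slopes at a common ramification level -/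

theorem mainTheorem6 (k : BaseField) (τ : ℂ) (hq : 1 < ‖(qOf τ : ℂ)‖) :
    -- the Newton function is well defined
    (∀ (M : Type*) [AddCommGroup M] [Module k.K M] [FiniteDimensional k.K M]
      (Φ : M ≃ₛₗ[(sigma k (qOf τ) : k.K →+* k.K)] M),
      IsNewtonFunction Φ (newtonFunction Φ) ∧
        ∀ r, IsNewtonFunction Φ r → r = newtonFunction Φ) ∧
    -- (i) additivity for exact sequences
    (∀ (M' M M'' : Type*)
      [AddCommGroup M'] [Module k.K M'] [FiniteDimensional k.K M']
      [AddCommGroup M] [Module k.K M] [FiniteDimensional k.K M]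
      [AddCommGroup M''] [Module k.K M''] [FiniteDimensional k.K M'']
      (Φ' : M' ≃ₛₗ[(sigma k (qOf τ) : k.K →+* k.K)] M')
      (Φ : M ≃ₛₗ[(sigma k (qOf τ) : k.K →+* k.K)] M)
      (Φ'' : M'' ≃ₛₗ[(sigma k (qOf τ) : k.K →+* k.K)] M'')
      (f : M' →ₗ[k.K] M) (g : M →ₗ[k.K] M''),
      (∀ x, f (Φ' x) = Φ (f x)) → (∀ x, g (Φ x) = Φ'' (g x)) →
      Function.Injective f → Function.Exact f g → Function.Surjective g →
        newtonFunction Φ = newtonFunction Φ' + newtonFunction Φ'' ∧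
        polygon (newtonFunction Φ) =
          polygon (newtonFunction Φ') + polygon (newtonFunction Φ'')) ∧
    -- (ii) multiplicativity for tensor products
    (∀ (M₁ M₂ : Type*)
      [AddCommGroup M₁] [Module k.K M₁] [FiniteDimensional k.K M₁]
      [AddCommGroup M₂] [Module k.K M₂] [FiniteDimensional k.K M₂]
      (Φ₁ : M₁ ≃ₛₗ[(sigma k (qOf τ) : k.K →+* k.K)] M₁)
      (Φ₂ : M₂ ≃ₛₗ[(sigma k (qOf τ) : k.K →+* k.K)] M₂) (μ : ℚ),
      newtonFunction (tensorAut Φ₁ Φ₂) μ =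
        ∑ p ∈ (newtonFunction Φ₁).support ×ˢ (newtonFunction Φ₂).support with p.1 + p.2 = μ,
          newtonFunction Φ₁ p.1 * newtonFunction Φ₂ p.2) ∧
    -- (iii) the dual
    (∀ (M : Type*) [AddCommGroup M] [Module k.K M] [FiniteDimensional k.K M]
      (Φ : M ≃ₛₗ[(sigma k (qOf τ) : k.K →+* k.K)] M) (μ : ℚ),
      newtonFunction (dualAut Φ) μ = newtonFunction Φ (-μ)) := by
  refine ⟨fun M _ _ _ Φ => ?_, fun M' M M'' _ _ _ _ _ _ _ _ _ Φ' Φ Φ'' f g hfΦ hgΦ hf hfg hg => ?_,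
    fun M₁ M₂ _ _ _ _ _ _ Φ₁ Φ₂ μ => ?_, fun M _ _ _ Φ μ => ?_⟩
  · obtain ⟨l, S, hS⟩ := exists_hasSlopes hq Φ
    rw [hS.newtonFunction_eq]
    refine ⟨(isNewtonFunction_iff Φ _).mpr ⟨l, S, hS, rfl⟩, fun r hr => ?_⟩
    obtain ⟨l', T, hT, rfl⟩ := (isNewtonFunction_iff Φ r).mp hr
    rw [hT.unique hS]
  · obtain ⟨l', S', hS'⟩ := exists_hasSlopes hq Φ'
    obtain ⟨l'', S'', hS''⟩ := exists_hasSlopes hq Φ''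
    -- Both outer modules are brought to the common level `l' * l''`.
    have h'' := hS''.mul_right l'
    rw [mul_comm] at h''
    have h := HasSlopes.of_exact f g hf hfg hg hfΦ hgΦ (hS'.mul_right l'') h''
    have heq : newtonFunction Φ = newtonFunction Φ' + newtonFunction Φ'' := by
      rw [h.newtonFunction_eq, hS'.newtonFunction_eq, hS''.newtonFunction_eq, map_add]
    exact ⟨heq, by rw [heq, polygon_add]⟩
  · obtain ⟨l₁, S, hS⟩ := exists_hasSlopes hq Φ₁
    obtain ⟨l₂, T, hT⟩ := exists_hasSlopes hq Φ₂
    have hT' := hT.mul_right l₁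
    rw [mul_comm] at hT'
    rw [((hS.mul_right l₂).tensor hT').newtonFunction_eq, hS.newtonFunction_eq,
      hT.newtonFunction_eq]
    simp only [Multiset.toFinsupp_apply, Multiset.toFinsupp_support]
    exact count_bind_add S T μ
  · obtain ⟨l, S, hS⟩ := exists_hasSlopes hq Φ
    rw [hS.dual.newtonFunction_eq, hS.newtonFunction_eq, Multiset.toFinsupp_apply,
      Multiset.toFinsupp_apply]
    -- Negation is injective, so the multiplicity of `μ` among the opposite slopes is that of `-μ`
    -- in `S`.
    have := Multiset.count_map_eq_count' (- ·) S neg_injective (-μ)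
    rwa [neg_neg] at this
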